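/- Let $K$ be a field of characteristic zero and let $q\in K$ be nonzero and not a root of unity. For $m,n\ge 1$ let $\mathcal O_q(M(m,n))$ be the $K$-algebra generated by $x_{ij}$ ($1\le i\le m$, $1\le j\le n$) subject to $$x_{ij}x_{il}=q\,x_{il}x_{ij}\ (j<l),\qquad x_{ij}x_{kj}=q\,x_{kj}x_{ij}\ (i<k),$$ $$x_{ij}x_{kl}=x_{kl}x_{ij}\ (k<i,\ j<l),\qquad x_{ij}x_{kl}-x_{kl}x_{ij}=(q-q^{-1})x_{il}x_{kj}\ (i<k,\ j<l).$$ Let $k,n$ be integers with $k\ge 2$ and $2k\le n$. For a $k$-subset $J=\{j_1<\dots<j_k\}$ of $\{1,\dots,n\}$ put $$[J]=\sum_{\sigma\in S_k}(-q)^{\ell(\sigma)}x_{1,j_{\sigma(1)}}\cdots x_{k,j_{\sigma(k)}}\in\mathcal O_q(M(k,n)),$$ where $\ell(\sigma)$ is the number of inversions of $\sigma$. The quantum grassmannian $\mathcal O_q(G(k,n))$ is the subalgebra of $\mathcal O_q(M(k,n))$ generated by all the $[J]$. Put $[u]=[1,\dots,k]$, $[w]=[n-k+1,\dots,n]$, and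 let $T=\mathcal O_q(G(k,n))[[u]^{-1}]$ be the localisation of $\mathcal O_q(G(k,n))$ at the powers of $[u]$. Let $R$ be the subalgebra of $T$ generated by the elements $$\bigl[(\{1,\dots,k\}\setminus\{k+1-i\})\cup\{k+j\}\bigr]\,[u]^{-1},\qquad 1\le i\le k,\ 1\le j\le n-k .$$ (This is the standard copy of $\mathcal O_q(M(k,n-k))$ in $T$, with respect to which $T$ is usually written as $\mathcal O_q(M(k,n-k))[y^{\pm1};\sigma]$, $y=[u]$; these identifications are recalled here and are not part of the assertion.) Let $D$ be a $K$-linear derivation of $\mathcal O_q(G(k,n))$ with $D([u])=D([w])=0$. Then $D$ extends uniquely to a $K$-linear derivation of $T$, again denoted by $D$; it satisfies $D([u]^{-1})=0$, and $D(R)\subseteq R$. -/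

import Mathlib

/-- Defining relations of the algebra of `m × n` quantum matrices, on the free algebra generated
by the indeterminates `x i j`. -/
inductive QMatRel {K : Type*} [Field K] (q : K) (m n : ℕ) :
    FreeAlgebra K (Fin m × Fin n) → FreeAlgebra K (Fin m × Fin n) → Prop
  | row (i : Fin m) (j l : Fin n) (hjl : j < l) :
      QMatRel q m n
        (FreeAlgebra.ι K (i, j) * FreeAlgebra.ι K (i, l))
        (q • (FreeAlgebra.ι K (i, l) * FreeAlgebra.ι K (i, j)))
  | col (i k : Fin m) (j : Fin n) (hik : i < k) :
      QMatRel q m n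
        (FreeAlgebra.ι K (i, j) * FreeAlgebra.ι K (k, j))
        (q • (FreeAlgebra.ι K (k, j) * FreeAlgebra.ι K (i, j)))
  | anti (i k : Fin m) (j l : Fin n) (hki : k < i) (hjl : j < l) :
      QMatRel q m n
        (FreeAlgebra.ι K (i, j) * FreeAlgebra.ι K (k, l))
        (FreeAlgebra.ι K (k, l) * FreeAlgebra.ι K (i, j))
  | diag (i k : Fin m) (j l : Fin n) (hik : i < k) (hjl : j < l) :
      QMatRel q m n
        (FreeAlgebra.ι K (i, j) * FreeAlgebra.ι K (k, l)
          - FreeAlgebra.ι K (k, l) * FreeAlgebra.ι K (i, j))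
        ((q - q⁻¹) • (FreeAlgebra.ι K (i, l) * FreeAlgebra.ι K (k, j)))

/-- The algebra `O_q(M(m,n))` of `m × n` quantum matrices over `K`. -/
abbrev QMat {K : Type*} [Field K] (q : K) (m n : ℕ) : Type _ := RingQuot (QMatRel q m n)

/-- The generator `x i j` of `O_q(M(m,n))`. -/
noncomputable def QMat.x {K : Type*} [Field K] (q : K) {m n : ℕ} (i : Fin m) (j : Fin n) :
    QMat q m n :=
  RingQuot.mkAlgHom K (QMatRel q m n) (FreeAlgebra.ι K (i, j))

/-- The length of a permutation: its number of inversions. -/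
def permLength {t : ℕ} (σ : Equiv.Perm (Fin t)) : ℕ :=
  (Finset.univ.filter fun p : Fin t × Fin t => p.1 < p.2 ∧ σ p.2 < σ p.1).card

/-- The quantum determinant
`∑ σ, (-q) ^ l(σ) • a 1 σ(1) * a 2 σ(2) * ⋯ * a t σ(t)` (factors in this order)
of a square array of elements of a `K`-algebra. -/
noncomputable def quantumDet {K : Type*} [Field K] (q : K) {A : Type*} [Ring A] [Algebra K A]
    {t : ℕ} (a : Fin t → Fin t → A) : A :=
  ∑ σ : Equiv.Perm (Fin t), (-q) ^ permLength σ • (List.ofFn fun i => a i (σ i)).prod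

/-- The `k × k` quantum minor of `O_q(M(k,n))` that uses all rows and the columns in the
`k`-element set `J`. -/
noncomputable def maximalMinor {K : Type*} [Field K] (q : K) {k n : ℕ} (J : Finset (Fin n))
    (hJ : J.card = k) : QMat q k n :=
  quantumDet q fun i j => QMat.x q i (J.orderEmbOfFin hJ j)

/-- The quantum grassmannian `O_q(G(k,n))`: the subalgebra of `O_q(M(k,n))` generated by the
`k × k` quantum minors. -/
noncomputable def QGrass {K : Type*} [Field K] (q : K) (k n : ℕ) : Subalgebra K (QMat q k n) :=
  Algebra.adjoin K {a | ∃ (J : Finset (Fin n)) (hJ : J.card = k), a = maximalMinor q J hJ}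

/-- The quantum Plücker coordinate `[J]`, as an element of the quantum grassmannian. -/
noncomputable def plucker {K : Type*} [Field K] (q : K) {k n : ℕ} (J : Finset (Fin n))
    (hJ : J.card = k) : QGrass q k n :=
  ⟨maximalMinor q J hJ, Algebra.subset_adjoin ⟨J, hJ, rfl⟩⟩

/-- The first `k` elements of `Fin n`, that is, `{1, …, k}` in `1`-based numbering. -/
def uSet (k n : ℕ) : Finset (Fin n) := Finset.univ.filter fun a => a.val < k

/-- The last `k` elements of `Fin n`, that is, `{n-k+1, …, n}` in `1`-based numbering. -/
def wSet (k n : ℕ) : Finset (Fin n) := Finset.univ.filter fun a => n ≤ a.val + k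

theorem card_uSet {k n : ℕ} (h : k ≤ n) : (uSet k n).card = k := by
  have h1 : uSet k n = (Finset.univ : Finset (Fin k)).map (Fin.castLEEmb h) := by
    ext a
    simp only [uSet, Finset.mem_filter, Finset.mem_univ, true_and, Finset.mem_map]
    exact ⟨fun ha => ⟨⟨a.val, ha⟩, rfl⟩, by rintro ⟨i, rfl⟩; exact i.isLt⟩
  rw [h1, Finset.card_map, Finset.card_univ, Fintype.card_fin]

theorem card_wSet {k n : ℕ} (h : k ≤ n) : (wSet k n).card = k := by
  have hinj : Function.Injective
      (fun i : Fin k => (⟨n - k + i.val, by have := i.isLt; omega⟩ : Fin n)) := by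
    intro a b hab
    have := congrArg Fin.val hab
    ext
    simpa using this
  have h1 : wSet k n = (Finset.univ : Finset (Fin k)).map ⟨_, hinj⟩ := by
    ext a
    simp only [wSet, Finset.mem_filter, Finset.mem_univ, true_and, Finset.mem_map,
      Function.Embedding.coeFn_mk]
    have ha' := a.isLt
    constructor
    · intro ha
      exact ⟨⟨a.val - (n - k), by omega⟩, Fin.ext (by simp; omega)⟩
    · rintro ⟨i, rfl⟩
      simp; omega
  rw [h1, Finset.card_map, Finset.card_univ, Fintype.card_fin]

/-- The column set of the Plücker coordinate in the numerator of `x i j`. In `1`-based numbering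
it is `({1, …, k} \ {k+1-i}) ∪ {j+k}`. -/
def xSet {k n : ℕ} (i : Fin k) (j : Fin (n - k)) : Finset (Fin n) :=
  insert ⟨j.val + k, by have := j.isLt; omega⟩
    ((uSet k n).erase ⟨k - 1 - i.val, by have := j.isLt; have := i.isLt; omega⟩)

theorem card_xSet {k n : ℕ} (i : Fin k) (j : Fin (n - k)) : (xSet i j).card = k := by
  have hi := i.isLt
  have hj := j.isLt
  rw [xSet, Finset.card_insert_of_notMem (by simp [uSet]),
    Finset.card_erase_of_mem (by simp [uSet]; omega), card_uSet (by omega)]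
  omega

/-- Relations that present the localisation of the `K`-algebra `A` at `s`: the generators `some a`
satisfy the relations of `A`, and `none` is a two-sided inverse of `some s`. -/
inductive InvRel (K : Type*) [Field K] {A : Type*} [Ring A] [Algebra K A] (s : A) :
    FreeAlgebra K (Option A) → FreeAlgebra K (Option A) → Prop
  | add (a b : A) : InvRel K s
      (FreeAlgebra.ι K (some (a + b))) (FreeAlgebra.ι K (some a) + FreeAlgebra.ι K (some b))
  | mul (a b : A) : InvRel K s
      (FreeAlgebra.ι K (some (a * b))) (FreeAlgebra.ι K (some a) * FreeAlgebra.ι K (some b))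
  | scalar (c : K) : InvRel K s
      (FreeAlgebra.ι K (some (algebraMap K A c))) (algebraMap K _ c)
  | mul_inv : InvRel K s (FreeAlgebra.ι K (some s) * FreeAlgebra.ι K none) 1
  | inv_mul : InvRel K s (FreeAlgebra.ι K none * FreeAlgebra.ι K (some s)) 1

/-- The localisation `A[s⁻¹]`: the universal `K`-algebra over `A` in which `s` is invertible
(see `InvertAt.lift_spec`). When `s` is a normal (more generally, Ore) element,
it is the usual ring of fractions with respect to the powers of `s`. -/
abbrev InvertAt (K : Type*) [Field K] {A : Type*} [Ring A] [Algebra K A] (s : A) : Type _ :=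
  RingQuot (InvRel K s)

/-- The canonical map `A → A[s⁻¹]`. -/
noncomputable def InvertAt.of (K : Type*) [Field K] {A : Type*} [Ring A] [Algebra K A] (s : A) :
    A →ₐ[K] InvertAt K s :=
  { toFun := fun a => RingQuot.mkAlgHom K (InvRel K s) (FreeAlgebra.ι K (some a))
    map_one' := by
      have h := RingQuot.mkAlgHom_rel K (InvRel.scalar (K := K) (s := s) 1)
      simpa using h
    map_zero' := by
      have h := RingQuot.mkAlgHom_rel K (InvRel.scalar (K := K) (s := s) 0)
      simpa using h
    map_mul' := fun a b => by
      have h := RingQuot.mkAlgHom_rel K (InvRel.mul (K := K) (s := s) a b)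
      simpa using h
    map_add' := fun a b => by
      have h := RingQuot.mkAlgHom_rel K (InvRel.add (K := K) (s := s) a b)
      simpa using h
    commutes' := fun c => by
      have h := RingQuot.mkAlgHom_rel K (InvRel.scalar (K := K) (s := s) c)
      simpa using h }

/-- The element `s⁻¹` of `A[s⁻¹]`. -/
noncomputable def InvertAt.inv (K : Type*) [Field K] {A : Type*} [Ring A] [Algebra K A] (s : A) :
    InvertAt K s :=
  RingQuot.mkAlgHom K (InvRel K s) (FreeAlgebra.ι K none)

theorem InvertAt.of_mul_inv (K : Type*) [Field K] {A : Type*} [Ring A] [Algebra K A] (s : A) :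
    InvertAt.of K s s * InvertAt.inv K s = 1 := by
  have h := RingQuot.mkAlgHom_rel K (InvRel.mul_inv (K := K) (s := s))
  rw [map_mul, map_one] at h
  exact h

theorem InvertAt.inv_mul_of (K : Type*) [Field K] {A : Type*} [Ring A] [Algebra K A] (s : A) :
    InvertAt.inv K s * InvertAt.of K s s = 1 := by
  have h := RingQuot.mkAlgHom_rel K (InvRel.inv_mul (K := K) (s := s))
  rw [map_mul, map_one] at h
  exact h

/-- The universal property of `A[s⁻¹]`: homomorphisms `A → B` that send `s` to a unit extend
uniquely to `A[s⁻¹]`. -/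
theorem InvertAt.lift_spec (K : Type*) [Field K] {A : Type*} [Ring A] [Algebra K A] (s : A)
    {B : Type*} [Ring B] [Algebra K B] (f : A →ₐ[K] B) (hf : IsUnit (f s)) :
    ∃! g : InvertAt K s →ₐ[K] B, g.comp (InvertAt.of K s) = f := by
  obtain ⟨v, hv⟩ := hf
  let F : FreeAlgebra K (Option A) →ₐ[K] B :=
    FreeAlgebra.lift K fun o => o.elim (↑v⁻¹ : B) f
  have hF : ∀ ⦃x y⦄, InvRel K s x y → F x = F y := by
    intro x y hxy
    cases hxy <;> simp [F, ← hv]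
  refine ⟨RingQuot.liftAlgHom K ⟨F, hF⟩, ?_, ?_⟩
  · ext a
    simp [InvertAt.of, F]
  · intro g hg
    have hs : ∀ a, g (InvertAt.of K s a) = f a := fun a => by rw [← hg]; rfl
    apply RingQuot.ringQuot_ext'
    ext o
    cases o with
    | some a =>
      have h1 := hs a
      simp only [InvertAt.of, AlgHom.coe_mk, RingHom.coe_mk, MonoidHom.coe_mk,
        OneHom.coe_mk] at h1
      simp [F, h1]
    | none =>
      have h1 : f s * g (InvertAt.inv K s) = 1 := by
        rw [← hs s, ← map_mul, InvertAt.of_mul_inv, map_one]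
      have h2 : g (InvertAt.inv K s) = ↑v⁻¹ := by
        rw [← hv] at h1
        exact (Units.inv_eq_of_mul_eq_one_right h1).symm
      simp only [InvertAt.inv] at h2
      simp [F, h2]

/-- `D` is a (`K`-linear) derivation of the possibly noncommutative `K`-algebra `A`. -/
def IsDeriv {K : Type*} [Field K] {A : Type*} [Semiring A] [Algebra K A] (D : A →ₗ[K] A) : Prop :=
  ∀ a b : A, D (a * b) = D a * b + a * D b

/-- The leftmost quantum Plücker coordinate `[u] = [1, …, k]`. -/
noncomputable def QGrass.u {K : Type*} [Field K] (q : K) {k n : ℕ} (h : k ≤ n) : QGrass q k n :=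
  plucker q (uSet k n) (card_uSet h)

/-- The rightmost quantum Plücker coordinate `[w] = [n-k+1, …, n]`. -/
noncomputable def QGrass.w {K : Type*} [Field K] (q : K) {k n : ℕ} (h : k ≤ n) : QGrass q k n :=
  plucker q (wSet k n) (card_wSet h)

/-- The localisation `T = O_q(G(k,n))[[u]⁻¹]`. -/
abbrev QGrassLoc {K : Type*} [Field K] (q : K) {k n : ℕ} (h : k ≤ n) : Type _ :=
  InvertAt K (QGrass.u q h)

/-- The canonical map `O_q(G(k,n)) → T`. -/
noncomputable abbrev QGrassLoc.of {K : Type*} [Field K] (q : K) {k n : ℕ} (h : k ≤ n) :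
    QGrass q k n →ₐ[K] QGrassLoc q h :=
  InvertAt.of K (QGrass.u q h)

/-- The element `y⁻¹ = [u]⁻¹` of `T`. -/
noncomputable abbrev QGrassLoc.uInv {K : Type*} [Field K] (q : K) {k n : ℕ} (h : k ≤ n) :
    QGrassLoc q h :=
  InvertAt.inv K (QGrass.u q h)

/-- The element `x i j = [({1, …, k} \ {k+1-i}) ∪ {j+k}] [u]⁻¹` of `T`. -/
noncomputable def QGrassLoc.x {K : Type*} [Field K] (q : K) {k n : ℕ} (h : k ≤ n) (i : Fin k)
    (j : Fin (n - k)) : QGrassLoc q h :=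
  QGrassLoc.of q h (plucker q (xSet i j) (card_xSet i j)) * QGrassLoc.uInv q h

/-- The quantum matrix subalgebra `R = O_q(M(k,n-k))` of `T`, generated by the `x i j`. -/
noncomputable def QGrassLoc.R {K : Type*} [Field K] (q : K) {k n : ℕ} (h : k ≤ n) :
    Subalgebra K (QGrassLoc q h) :=
  Algebra.adjoin K {a | ∃ (i : Fin k) (j : Fin (n - k)), a = QGrassLoc.x q h i j}

/-- `D'` is a derivation of `T` that extends the linear map `D` on `O_q(G(k,n))`. -/
def QGrassLoc.IsExtension {K : Type*} [Field K] (q : K) {k n : ℕ} (h : k ≤ n)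
    (D : QGrass q k n →ₗ[K] QGrass q k n) (D' : QGrassLoc q h →ₗ[K] QGrassLoc q h) : Prop :=
  IsDeriv D' ∧ ∀ a : QGrass q k n, D' (QGrassLoc.of q h a) = QGrassLoc.of q h (D a)

-- Let `g` be the numerator of a generator of `R`. Both [u] and [w] q-commute with every Plücker
-- coordinate: [u][J] = q^a [J][u] and [J][w] = q^b [w][J], where a and b count the columns of J
-- outside those of [u] and of [w] (`u_mul_plucker`, `plucker_mul_w`). For `g` one has a = 1 and,
-- because 2k ≤ n, b is k or k-1. Since D kills [u] and [w], applying D to the two relations shows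
-- that D g satisfies the same relations as `g`.
--
-- Monomials in the Plücker coordinates are eigenvectors for conjugation by [u], with eigenvalue
-- q^α, where α is the total number of columns beyond the k-th. As q is not a root of unity, only α
-- = 1 contributes to D g, and those monomials are scalar multiples of g'[u]^d with g' again such a
-- numerator (`of_mem_span_of_qcommute`). Moving [w] past g'[u]^d costs q^(b'+kd) with b' ≥ k-1, and
-- b'+kd = b ≤ k forces d = 0 because k ≥ 2. So D g is a linear combination of numerators g'
-- (`of_mem_span_plucker`), D(g[u]⁻¹) = D(g)[u]⁻¹ lies in `R`, and the Leibniz rule does the rest.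
--
-- Comparing coefficients requires the elements [w]g'[u]^d to be linearly independent in T
-- (`linearIndependent_w_mul`). Their column multidegrees are distinct, so it is enough that they
-- are nonzero. This is seen in a representation in which [u] is invertible and all maximal minors
-- act injectively (`hasModel_univ`): start from the identity matrix and repeatedly multiply two
-- adjacent columns by a triangular quantum matrix with entries in a quantum torus.
--
-- Minors are handled through the quantum exterior algebra. With θ_i = ∑ x_ij e_j, the coefficient
-- of e_J in θ_1⋯θ_k·1 is the minor [J] (`prod_theta_pi_single`), so commutation and base change of
-- minors become operator identities for the product of the θ_i.

universe u

/-! ### Quantum matrices in arbitrary algebras, and products of sums -/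

/-- A rectangular array of elements of a `K`-algebra that satisfies the relations between the
generators of the algebra of quantum matrices. -/
structure IsQuantumMatrix {K : Type*} [Field K] (q : K) {A : Type*} [Ring A] [Algebra K A]
    {m n : ℕ} (x : Fin m → Fin n → A) : Prop where
  row : ∀ (i : Fin m) (j l : Fin n), j < l → x i j * x i l = q • (x i l * x i j)
  col : ∀ (i k : Fin m) (j : Fin n), i < k → x i j * x k j = q • (x k j * x i j)
  anti : ∀ (i k : Fin m) (j l : Fin n), k < i → j < l → x i j * x k l = x k l * x i j
  diag : ∀ (i k : Fin m) (j l : Fin n), i < k → j < l →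
    x i j * x k l - x k l * x i j = (q - q⁻¹) • (x i l * x k j)

section QuantumMatrix

variable {K : Type*} [Field K] (q : K) {A B : Type*} [Ring A] [Algebra K A] [Ring B] [Algebra K B]

theorem QMat.isQuantumMatrix (m n : ℕ) :
    IsQuantumMatrix q (fun (i : Fin m) (j : Fin n) => QMat.x q i j) where
  row i j l h := by
    simpa [QMat.x] using RingQuot.mkAlgHom_rel K (QMatRel.row (q := q) i j l h)
  col i k j h := by
    simpa [QMat.x] using RingQuot.mkAlgHom_rel K (QMatRel.col (q := q) i k j h)
  anti i k j l h h' := by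
    simpa [QMat.x] using RingQuot.mkAlgHom_rel K (QMatRel.anti (q := q) i k j l h h')
  diag i k j l h h' := by
    simpa [QMat.x] using RingQuot.mkAlgHom_rel K (QMatRel.diag (q := q) i k j l h h')

variable {q}

theorem IsQuantumMatrix.map {m n : ℕ} {x : Fin m → Fin n → A} (hx : IsQuantumMatrix q x)
    (f : A →ₐ[K] B) : IsQuantumMatrix q (fun i j => f (x i j)) where
  row i j l h := by simp only [← map_mul, ← map_smul, hx.row i j l h]
  col i k j h := by simp only [← map_mul, ← map_smul, hx.col i k j h]
  anti i k j l h h' := by simp only [← map_mul, hx.anti i k j l h h']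
  diag i k j l h h' := by simp only [← map_mul, ← map_smul, ← map_sub, hx.diag i k j l h h']

/-- Every quantum matrix is the image of the generic one. -/
theorem IsQuantumMatrix.exists_algHom {m n : ℕ} {x : Fin m → Fin n → A}
    (hx : IsQuantumMatrix q x) :
    ∃ f : QMat q m n →ₐ[K] A, ∀ i j, f (QMat.x q i j) = x i j := by
  let F : FreeAlgebra K (Fin m × Fin n) →ₐ[K] A := FreeAlgebra.lift K fun p => x p.1 p.2
  have hF : ∀ ⦃a b⦄, QMatRel q m n a b → F a = F b := by
    intro a b hab
    cases hab with
    | row i j l h => simpa [F] using hx.row i j l h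
    | col i k j h => simpa [F] using hx.col i k j h
    | anti i k j l h h' => simpa [F] using hx.anti i k j l h h'
    | diag i k j l h h' => simpa [F] using hx.diag i k j l h h'
  exact ⟨RingQuot.liftAlgHom K ⟨F, hF⟩, fun i j => by simp [QMat.x, F]⟩

theorem map_quantumDet {t : ℕ} (a : Fin t → Fin t → A) (f : A →ₐ[K] B) :
    f (quantumDet q a) = quantumDet q fun i j => f (a i j) := by
  simp only [quantumDet, map_sum, map_smul, map_list_prod, List.map_ofFn]
  rfl

/-- The quantum minor of an array with the columns in `J` and all the rows. -/
noncomputable def columnMinor (q : K) {k n : ℕ} (x : Fin k → Fin n → A) (J : Finset (Fin n))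
    (hJ : J.card = k) : A :=
  quantumDet q fun i j => x i (J.orderEmbOfFin hJ j)

theorem map_columnMinor {k n : ℕ} (x : Fin k → Fin n → A) (J : Finset (Fin n))
    (hJ : J.card = k) (f : A →ₐ[K] B) :
    f (columnMinor q x J hJ) = columnMinor q (fun i j => f (x i j)) J hJ :=
  map_quantumDet _ f

end QuantumMatrix

theorem prod_ofFn_sum {A ι : Type*} [Ring A] [Fintype ι] {k : ℕ} (f : Fin k → ι → A) :
    (List.ofFn fun i => ∑ j, f i j).prod
      = ∑ c : Fin k → ι, (List.ofFn fun i => f i (c i)).prod := by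
  classical
  have h := (MultilinearMap.mkPiAlgebraFin ℤ k A).map_sum (fun i j => f i j)
  simpa [MultilinearMap.mkPiAlgebraFin_apply] using h

theorem prod_ofFn_mul_of_commute {A : Type*} [Ring A] :
    ∀ {k : ℕ} (x e : Fin k → A), (∀ i j, Commute (e i) (x j)) →
      (List.ofFn fun i => x i * e i).prod = (List.ofFn x).prod * (List.ofFn e).prod
  | 0, _, _, _ => by simp
  | k + 1, x, e, h => by
    have ih := prod_ofFn_mul_of_commute (fun i : Fin k => x i.succ) (fun i => e i.succ)
      (fun i j => h _ _)
    have hc : Commute (e 0) (List.ofFn fun i : Fin k => x i.succ).prod := by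
      apply Commute.list_prod_right
      intro y hy
      obtain ⟨i, rfl⟩ := List.mem_ofFn.1 hy
      exact h _ _
    simp only [List.ofFn_succ, List.prod_cons, ih]
    rw [mul_assoc, ← mul_assoc (e 0), hc.eq]
    simp only [mul_assoc]

/-! ### The quantum exterior algebra with coefficients in a module -/

section Exterior

variable {K : Type*} [Field K] (q : K) {n : ℕ} {V : Type*} [AddCommGroup V] [Module K V]

variable (K V n) in
/-- The action of an endomorphism on the coefficients of elements of the exterior algebra. -/
def coeffwise : Module.End K V →ₐ[K] Module.End K (Finset (Fin n) → V) where
  toFun x := LinearMap.compLeft x (Finset (Fin n))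
  map_one' := rfl
  map_zero' := rfl
  map_mul' _ _ := rfl
  map_add' _ _ := rfl
  commutes' _ := rfl

@[simp]
theorem coeffwise_apply (x : Module.End K V) (f : Finset (Fin n) → V) (S : Finset (Fin n)) :
    coeffwise K n V x f S = x (f S) := rfl

variable (V) in
/-- Left multiplication by the `j`-th generator on the quantum exterior algebra with
coefficients in `V`. -/
def wedge (j : Fin n) : Module.End K (Finset (Fin n) → V) where
  toFun f S := if j ∈ S then (-q) ^ (S.filter (· < j)).card • f (S.erase j) else 0
  map_add' f g := by ext S; by_cases h : j ∈ S <;> simp [h]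
  map_smul' c f := by
    ext S
    by_cases h : j ∈ S
    · simp only [h, if_true, Pi.smul_apply, RingHom.id_apply, smul_comm c]
    · simp [h]

/-- A function `f` stands for ∑ f(S) e_S, with e_S the increasing product; the power of -q is the
cost of moving e_j past the smaller generators of e_S. -/
theorem wedge_apply (j : Fin n) (f : Finset (Fin n) → V) (S : Finset (Fin n)) :
    wedge q V j f S = if j ∈ S then (-q) ^ (S.filter (· < j)).card • f (S.erase j) else 0 := rfl

theorem wedge_commute (j : Fin n) (x : Module.End K V) :
    Commute (wedge q V j) (coeffwise K n V x) := by
  refine LinearMap.ext fun f => funext fun S => ?_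
  by_cases h : j ∈ S <;> simp [wedge_apply, h]

theorem wedge_mul_self (j : Fin n) : wedge q V j * wedge q V j = 0 := by
  refine LinearMap.ext fun f => funext fun S => ?_
  simp [wedge_apply]

theorem wedge_mul_of_lt {j l : Fin n} (h : j < l) :
    wedge q V l * wedge q V j = (-q) • (wedge q V j * wedge q V l) := by
  refine LinearMap.ext fun f => funext fun S => ?_
  by_cases hj : j ∈ S <;> by_cases hl : l ∈ S <;> simp [wedge_apply, hj, hl, h.ne, h.ne']
  have h1 : ((S.erase l).filter (· < j)) = S.filter (· < j) := by
    ext a; simp only [Finset.mem_filter, Finset.mem_erase]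
    exact ⟨fun h' => ⟨h'.1.2, h'.2⟩, fun h' => ⟨⟨(h'.2.trans h).ne, h'.1⟩, h'.2⟩⟩
  have h2 : (S.filter (· < l)).card = ((S.erase j).filter (· < l)).card + 1 := by
    have : (S.erase j).filter (· < l) = (S.filter (· < l)).erase j := by
      ext a; simp only [Finset.mem_filter, Finset.mem_erase, and_assoc]
    rw [this, Finset.card_erase_add_one]
    simp [hj, h]
  rw [h1, h2, pow_succ, Finset.erase_right_comm, smul_smul, ← neg_smul, smul_smul, smul_smul]
  congr 1
  ring

theorem wedge_pi_single {j : Fin n} {S : Finset (Fin n)} (v : V) :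
    wedge q V j (Pi.single S v)
      = if j ∈ S then 0 else Pi.single (insert j S) ((-q) ^ (S.filter (· < j)).card • v) := by
  ext U
  by_cases hj : j ∈ S
  · by_cases hU : j ∈ U <;> simp [wedge_apply, hj, hU, Pi.single_apply]
    rintro rfl
    simp at hj
  · simp only [wedge_apply, hj, if_false, Pi.single_apply]
    by_cases hU : j ∈ U
    · have h1 : U.erase j = S ↔ U = insert j S :=
        ⟨fun h => by rw [← h, Finset.insert_erase hU],
         fun h => by rw [h, Finset.erase_insert hj]⟩
      by_cases h : U = insert j S
      · subst h
        simp [Finset.filter_insert, hj]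
      · simp [h, h1]
    · have : U ≠ insert j S := fun h => hU (h ▸ Finset.mem_insert_self _ _)
      simp [hU, this]

end Exterior

/-! ### Minors as coefficients in the exterior algebra -/

/-- The number of inversions of a sequence. -/
def inversions {α : Type*} [LinearOrder α] {t : ℕ} (c : Fin t → α) : ℕ :=
  (Finset.univ.filter fun p : Fin t × Fin t => p.1 < p.2 ∧ c p.2 < c p.1).card

theorem inversions_succ {α : Type*} [LinearOrder α] {t : ℕ} (c : Fin (t + 1) → α) :
    inversions c = (Finset.univ.filter fun i : Fin t => c i.succ < c 0).card
      + inversions fun i : Fin t => c i.succ := by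
  simp only [inversions, Finset.card_filter, Fintype.sum_prod_type, Fin.sum_univ_succ]
  simp

theorem permLength_eq_inversions {α : Type*} [LinearOrder α] {t : ℕ} {g : Fin t → α}
    (hg : StrictMono g) (σ : Equiv.Perm (Fin t)) :
    inversions (fun i => g (σ i)) = permLength σ := by
  simp [inversions, permLength, hg.lt_iff_lt]

section Expansion

variable {K : Type*} [Field K] (q : K) {n : ℕ} {V : Type*} [AddCommGroup V] [Module K V]

/-- Sorting the product e_c(0) e_c(1) ⋯ costs one factor -q per inversion, and a repeated index
gives zero. The induction inserts the leftmost factor last. -/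
theorem prod_wedge_pi_single : ∀ {k : ℕ} (c : Fin k → Fin n) (v : V),
    (List.ofFn fun i => wedge q V (c i)).prod (Pi.single ∅ v)
      = if Function.Injective c then
          Pi.single (Finset.univ.image c) ((-q) ^ inversions c • v) else 0
  | 0, c, v => by
    have : Function.Injective c := fun i => i.elim0
    simp [this, inversions]
  | k + 1, c, v => by
    have ih := prod_wedge_pi_single (fun i : Fin k => c i.succ) v
    rw [List.ofFn_succ, List.prod_cons, Module.End.mul_apply, ih]
    have hinj : Function.Injective c ↔
        Function.Injective (fun i : Fin k => c i.succ) ∧ c 0 ∉ Finset.univ.image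
          (fun i : Fin k => c i.succ) := by
      conv_lhs => rw [← Fin.cons_self_tail c, Fin.cons_injective_iff]
      simp only [Set.mem_range, Finset.mem_image, Finset.mem_univ, true_and, Fin.tail]
      exact and_comm
    by_cases h1 : Function.Injective (fun i : Fin k => c i.succ)
    · rw [if_pos h1, wedge_pi_single]
      by_cases h2 : c 0 ∈ Finset.univ.image (fun i : Fin k => c i.succ)
      · rw [if_pos h2, if_neg (by rw [hinj]; tauto)]
      · rw [if_neg h2, if_pos (by rw [hinj]; tauto), smul_smul, ← pow_add, inversions_succ]
        have h3 : Finset.univ.image c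
            = insert (c 0) (Finset.univ.image (fun i : Fin k => c i.succ)) := by
          ext a
          simp only [Finset.mem_image, Finset.mem_univ, true_and, Finset.mem_insert,
            Fin.exists_fin_succ, eq_comm]
        have h4 : ((Finset.univ.image (fun i : Fin k => c i.succ)).filter (· < c 0)).card
            = (Finset.univ.filter fun i : Fin k => c i.succ < c 0).card := by
          rw [Finset.filter_image, Finset.card_image_of_injective _ h1]
        rw [h3, h4]
    · rw [if_neg h1, if_neg (by rw [hinj]; tauto), map_zero]

/-- The expansion of a product of linear combinations of the generators of the quantum exterior
algebra in terms of quantum minors. -/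
theorem prod_theta_pi_single {k : ℕ} (X : Fin k → Fin n → Module.End K V) (J : Finset (Fin n))
    (hJ : J.card = k) (v : V) (w : Fin n → Module.End K (Finset (Fin n) → V))
    (hw : ∀ j ∈ J, w j = wedge q V j) (hw' : ∀ j ∉ J, w j = wedge q V j ∨ w j = 0) :
    (List.ofFn fun i => ∑ j, coeffwise K n V (X i j) * w j).prod (Pi.single ∅ v) J
      = columnMinor q X J hJ v := by
  classical
  have hcomm : ∀ i j l, Commute (w l) (coeffwise K n V (X i j)) := by
    intro i j l
    have : w l = wedge q V l ∨ w l = 0 := by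
      by_cases h : l ∈ J
      · exact Or.inl (hw l h)
      · exact hw' l h
    rcases this with h | h <;> rw [h]
    · exact wedge_commute q l _
    · exact Commute.zero_left _
  -- Only the sequences that enumerate J without repetition reach the coefficient of e_J; for these
  -- every factor `w` is a genuine generator.
  have hterm : ∀ c : Fin k → Fin n,
      (List.ofFn fun i => coeffwise K n V (X i (c i)) * w (c i)).prod (Pi.single ∅ v) J
        = if Function.Injective c ∧ Finset.univ.image c = J then
          (-q) ^ inversions c • (List.ofFn fun i => X i (c i)).prod v else 0 := by
    intro c
    rw [prod_ofFn_mul_of_commute _ _ (fun i j => hcomm _ _ _)]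
    have h1 : (List.ofFn fun i => coeffwise K n V (X i (c i))).prod
        = coeffwise K n V (List.ofFn fun i => X i (c i)).prod := by
      rw [map_list_prod, List.map_ofFn]; rfl
    rw [h1, Module.End.mul_apply, coeffwise_apply]
    have hzero : ∀ c : Fin k → Fin n, ¬ (∀ i, w (c i) = wedge q V (c i)) →
        (List.ofFn fun i => w (c i)).prod = 0 := by
      intro c hc
      push Not at hc
      obtain ⟨i, hi⟩ := hc
      have hwi : w (c i) = 0 := by
        by_cases h : c i ∈ J
        · exact absurd (hw _ h) hi
        · exact (hw' _ h).resolve_left hi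
      exact List.prod_eq_zero (List.mem_ofFn.2 ⟨i, hwi⟩)
    by_cases hc : ∀ i, w (c i) = wedge q V (c i)
    · simp only [hc, prod_wedge_pi_single]
      by_cases h2 : Function.Injective c
      · by_cases h3 : Finset.univ.image c = J
        · simp [h2, h3]
        · simp [h2, h3, eq_comm (a := J)]
      · simp [h2]
    · rw [hzero c hc, if_neg]
      · simp
      · rintro ⟨-, h3⟩
        exact hc fun i => hw _ (h3 ▸ Finset.mem_image_of_mem c (Finset.mem_univ i))
  rw [prod_ofFn_sum, LinearMap.sum_apply, Finset.sum_apply, Finset.sum_congr rfl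
    (fun c _ => hterm c), ← Finset.sum_filter, columnMinor, quantumDet, LinearMap.sum_apply]
  symm
  -- The enumerations of J are the increasing one composed with permutations, and their inversions
  -- are those of the permutation.
  refine Finset.sum_bij (fun σ _ => fun i => J.orderEmbOfFin hJ (σ i)) ?_ ?_ ?_ ?_
  · intro σ _
    simp only [Finset.mem_filter, Finset.mem_univ, true_and]
    refine ⟨(J.orderEmbOfFin hJ).injective.comp σ.injective, ?_⟩
    have h := Finset.image_image (s := Finset.univ) (f := σ) (g := J.orderEmbOfFin hJ)
    rw [Finset.image_univ_equiv, Finset.image_orderEmbOfFin_univ] at h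
    exact h.symm
  · intro σ _ τ _ h
    ext i
    exact congrArg Fin.val ((J.orderEmbOfFin hJ).injective (congrFun h i))
  · intro c hc
    simp only [Finset.mem_filter, Finset.mem_univ, true_and] at hc
    have hmem : ∀ i, ∃ j, J.orderEmbOfFin hJ j = c i := by
      intro i
      have : c i ∈ Set.range (J.orderEmbOfFin hJ) := by
        rw [Finset.range_orderEmbOfFin]
        exact hc.2 ▸ Finset.mem_image_of_mem c (Finset.mem_univ i)
      exact this
    choose s hs using hmem
    have hsinj : Function.Injective s := fun i j h => hc.1 (by rw [← hs, ← hs, h])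
    refine ⟨Equiv.ofBijective s (Finite.injective_iff_bijective.1 hsinj), Finset.mem_univ _, ?_⟩
    funext i
    exact hs i
  · intro σ _
    rw [permLength_eq_inversions (J.orderEmbOfFin hJ).strictMono]
    rfl

end Expansion

/-- Quantum matrix relations equate neither the (j,l) nor the (l,j) summands separately, only their
sum; hence the comparison by unordered pairs. -/
theorem sum_sum_eq_of_pairs {M : Type*} [AddCommMonoid M] {n : ℕ} (F G : Fin n → Fin n → M)
    (h : ∀ j l, j < l → F j l + F l j = G j l + G l j) (h0 : ∀ j, F j j = G j j) :
    ∑ j, ∑ l, F j l = ∑ j, ∑ l, G j l := by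
  have key : ∀ H : Fin n → Fin n → M, ∑ j, ∑ l, H j l
      = ∑ j, ∑ l, (if j < l then H j l + H l j else 0) + ∑ j, H j j := by
    intro H
    have h1 : ∀ j l, H j l = (if j < l then H j l else 0) + (if l < j then H j l else 0)
        + (if j = l then H j j else 0) := by
      intro j l
      rcases lt_trichotomy j l with h | h | h
      · simp [h, h.not_gt, h.ne]
      · subst h; simp
      · simp [h, h.not_gt, h.ne']
    have h2 : ∑ j, ∑ l, (if l < j then H j l else 0) = ∑ j, ∑ l, (if j < l then H l j else 0) :=
      Finset.sum_comm
    calc _ = ∑ j, ∑ l, ((if j < l then H j l else 0) + (if l < j then H j l else 0)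
        + (if j = l then H j j else 0)) :=
          Finset.sum_congr rfl fun j _ => Finset.sum_congr rfl fun l _ => h1 j l
      _ = _ := by
        simp only [Finset.sum_add_distrib, h2, Finset.sum_ite_eq, Finset.mem_univ, if_true]
        refine congrArg (· + ∑ j, H j j) ?_
        simp only [← Finset.sum_add_distrib]
        refine Finset.sum_congr rfl fun j _ => Finset.sum_congr rfl fun l _ => ?_
        split_ifs <;> simp
  rw [key F, key G]
  rw [Finset.sum_congr rfl fun j _ => h0 j]
  refine congrArg (· + ∑ j, G j j)
    (Finset.sum_congr rfl fun j _ => Finset.sum_congr rfl fun l _ => ?_)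
  split_ifs with hjl
  · exact h j l hjl
  · rfl

/-! ### Moving matrix entries past the product of coactions -/

section Theta

variable {K : Type*} [Field K] {q : K} {S : Type*} [Ring S] [Algebra K S] {k n : ℕ}

/-- The generators of the quantum exterior algebra. -/
structure IsExterior (q : K) (e : Fin n → S) : Prop where
  sq : ∀ j, e j * e j = 0
  swap : ∀ j l, j < l → e l * e j = (-q) • (e j * e l)

/-- The coaction of a matrix on a generator of the quantum exterior algebra. -/
def theta (x : Fin k → Fin n → S) (e : Fin n → S) (i : Fin k) : S := ∑ j, x i j * e j

theorem mul_mul_mul_comm_of_commute {a b c d : S} (h : Commute b c) :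
    a * b * (c * d) = a * c * (b * d) := by
  rw [mul_assoc, ← mul_assoc b, h.eq, mul_assoc, mul_assoc]

theorem smul_mul_mul (r : K) (a b c : S) : r • (a * b * c) = r • (a * b) * c :=
  (smul_mul_assoc r (a * b) c).symm

theorem theta_mul_theta {x : Fin k → Fin n → S} {e f : Fin n → S}
    (hc : ∀ i j l, Commute (e l) (x i j)) (i i' : Fin k) :
    theta x e i * theta x f i' = ∑ j, ∑ l, x i j * x i' l * (e j * f l) := by
  simp only [theta, Finset.sum_mul_sum]
  exact Finset.sum_congr rfl fun j _ => Finset.sum_congr rfl fun l _ =>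
    mul_mul_mul_comm_of_commute (hc _ _ _)

theorem pair_eq {e : Fin n → S} (he : IsExterior q e) {j l : Fin n} (h : j < l) (a b : S) :
    a * (e j * e l) + b * (e l * e j) = (a - q • b) * (e j * e l) := by
  rw [he.swap j l h, sub_mul, neg_smul, mul_neg, mul_smul_comm, smul_mul_assoc, sub_eq_add_neg]

/-- The rows of a quantum matrix coact by algebra maps: after collecting the two orders of e_j e_l,
each coefficient identity is one of the four quantum matrix relations. -/
theorem theta_isExterior {x : Fin k → Fin n → S} {e : Fin n → S} (hq : q ≠ 0)
    (hx : IsQuantumMatrix q x) (he : IsExterior q e)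
    (hc : ∀ i j l, Commute (e l) (x i j)) : IsExterior q (theta x e) where
  sq i := by
    rw [theta_mul_theta hc]
    have := sum_sum_eq_of_pairs (fun j l => x i j * x i l * (e j * e l)) (fun _ _ => 0)
      (fun j l h => by
        rw [pair_eq he h, hx.row i j l h]; simp)
      (fun j => by simp [he.sq])
    simpa using this
  swap i i' hi := by
    rw [theta_mul_theta hc, theta_mul_theta hc]
    simp only [Finset.smul_sum, ← smul_mul_assoc]
    apply sum_sum_eq_of_pairs
    · intro j l h
      rw [pair_eq he h, pair_eq he h]
      congr 1
      have h1 := hx.diag i i' j l hi h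
      have h2 := hx.anti i' i j l hi h
      rw [h2]
      simp only [smul_mul_assoc]
      linear_combination (norm := (match_scalars <;> field_simp <;> ring)) q • h1
    · intro j
      simp [he.sq]

/-- Moving `P a` to the right creates corrections only after it has passed `θ a`. Each of them can
be rewritten to start with `θ a`, so it dies because θ_a² = 0. -/
theorem mul_prod_theta_of_lower {θ P : Fin k → S} {s κ : K} (hθ : IsExterior q θ)
    (hlt : ∀ a i, i < a → P a * θ i = θ i * P a)
    (heq : ∀ a, P a * θ a = s • (θ a * P a))
    (hgt : ∀ a i, a < i → P a * θ i = θ i * P a + κ • (θ a * P i)) (a : Fin k) :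
    P a * (List.ofFn θ).prod = s • ((List.ofFn θ).prod * P a) := by
  -- All corrections are collected as one multiple of `θ a` from the left; their exact form `Z` is
  -- irrelevant.
  have aux : ∀ l : List (Fin k), (∀ i ∈ l, a < i) →
      ∃ Z, P a * (l.map θ).prod = (l.map θ).prod * P a + θ a * Z := by
    intro l
    induction l with
    | nil => exact fun _ => ⟨0, by simp⟩
    | cons i l ih =>
      intro h
      obtain ⟨Z, hZ⟩ := ih fun i' hi' => h i' (List.mem_cons_of_mem _ hi')
      have hi := h i List.mem_cons_self
      refine ⟨(-q) • (θ i * Z) + κ • (P i * (l.map θ).prod), ?_⟩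
      rw [List.map_cons, List.prod_cons, ← mul_assoc, hgt a i hi, add_mul, mul_assoc, hZ, mul_add,
        ← mul_assoc (θ i) (θ a), hθ.swap a i hi]
      simp only [mul_add, mul_smul_comm, smul_mul_assoc, mul_assoc, add_assoc]
  have main : ∀ l : List (Fin k), l.Pairwise (· < ·) → a ∈ l →
      P a * (l.map θ).prod = s • ((l.map θ).prod * P a) := by
    intro l
    induction l with
    | nil => simp
    | cons i l ih =>
      intro hl ha
      rw [List.pairwise_cons] at hl
      rcases List.mem_cons.1 ha with rfl | ha
      · obtain ⟨Z, hZ⟩ := aux l hl.1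
        rw [List.map_cons, List.prod_cons, ← mul_assoc, heq, smul_mul_assoc, mul_assoc, hZ,
          mul_add, ← mul_assoc (θ a) (θ a), hθ.sq, zero_mul, add_zero, mul_assoc]
      · rw [List.map_cons, List.prod_cons, ← mul_assoc, hlt a i (hl.1 a ha), mul_assoc,
          ih hl.2 ha, mul_smul_comm, mul_assoc]
  rw [List.ofFn_eq_map]
  exact main _ (List.pairwise_lt_finRange k) (List.mem_finRange a)

/-- Here corrections arise before `P a` meets `θ a`. A correction introduces an early `θ a`, its `P
i` commutes with all later factors, and the remaining product still contains `θ a`, so the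
correction vanishes. -/
theorem mul_prod_theta_of_upper {θ P : Fin k → S} {s κ : K} (hθ : IsExterior q θ)
    (hgt : ∀ a i, a < i → P a * θ i = θ i * P a)
    (heq : ∀ a, P a * θ a = s • (θ a * P a))
    (hlt : ∀ a i, i < a → P a * θ i = θ i * P a + κ • (θ a * P i)) (a : Fin k) :
    P a * (List.ofFn θ).prod = s • ((List.ofFn θ).prod * P a) := by
  have aux : ∀ b, ∀ l : List (Fin k), (∀ i ∈ l, b < i) →
      P b * (l.map θ).prod = (l.map θ).prod * P b := by
    intro b l
    induction l with
    | nil => simp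
    | cons i l ih =>
      intro h
      rw [List.map_cons, List.prod_cons, ← mul_assoc, hgt b i (h i List.mem_cons_self), mul_assoc,
        ih fun i' hi' => h i' (List.mem_cons_of_mem _ hi'), mul_assoc]
  have zero : ∀ l : List (Fin k), l.Pairwise (· < ·) → a ∈ l → θ a * (l.map θ).prod = 0 := by
    intro l
    induction l with
    | nil => simp
    | cons i l ih =>
      intro hl ha
      rw [List.pairwise_cons] at hl
      rcases List.mem_cons.1 ha with rfl | ha
      · rw [List.map_cons, List.prod_cons, ← mul_assoc, hθ.sq, zero_mul]
      · rw [List.map_cons, List.prod_cons, ← mul_assoc, hθ.swap i a (hl.1 a ha), smul_mul_assoc,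
          mul_assoc, ih hl.2 ha, mul_zero, smul_zero]
  have main : ∀ l : List (Fin k), l.Pairwise (· < ·) → a ∈ l →
      P a * (l.map θ).prod = s • ((l.map θ).prod * P a) := by
    intro l
    induction l with
    | nil => simp
    | cons i l ih =>
      intro hl ha
      rw [List.pairwise_cons] at hl
      rcases List.mem_cons.1 ha with rfl | ha
      · rw [List.map_cons, List.prod_cons, ← mul_assoc, heq, smul_mul_assoc, mul_assoc,
          aux a l hl.1, mul_assoc]
      · rw [List.map_cons, List.prod_cons, ← mul_assoc, hlt a i (hl.1 a ha), add_mul, mul_assoc,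
          ih hl.2 ha, smul_mul_assoc, mul_assoc (θ a), aux i l hl.1, ← mul_assoc (θ a),
          zero l hl.2 ha, zero_mul, smul_zero, add_zero, mul_smul_comm, mul_assoc]
  rw [List.ofFn_eq_map]
  exact main _ (List.pairwise_lt_finRange k) (List.mem_finRange a)

/-- An entry to the right of all the columns that are involved. -/
theorem mul_prod_theta_right {x : Fin k → Fin n → S} {e : Fin n → S} (hq : q ≠ 0)
    (hx : IsQuantumMatrix q x) (he : IsExterior q e)
    (hc : ∀ i j l, Commute (e l) (x i j)) (c : Fin n) (hcol : ∀ j, c ≤ j → e j = 0) (a : Fin k) :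
    x a c * (List.ofFn (theta x e)).prod = q⁻¹ • ((List.ofFn (theta x e)).prod * x a c) := by
  have hmul : ∀ a i, x a c * theta x e i = ∑ j, x a c * x i j * e j := fun a i => by
    simp only [theta, Finset.mul_sum, mul_assoc]
  have hmul' : ∀ a i, theta x e i * x a c = ∑ j, x i j * x a c * e j := fun a i => by
    simp only [theta, Finset.sum_mul, mul_assoc, (hc _ _ _).eq]
  -- The correction is the diagonal relation solved for the product in the opposite order, whence
  -- the minus sign in κ.
  refine mul_prod_theta_of_upper (P := fun a => x a c) (κ := -(q - q⁻¹))
    (theta_isExterior hq hx he hc) ?_ ?_ ?_ a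
  · intro a i hi
    rw [hmul, hmul']
    refine Finset.sum_congr rfl fun j _ => ?_
    rcases lt_or_ge j c with h | h
    · rw [hx.anti i a j c hi h]
    · simp [hcol j h]
  · intro a
    rw [hmul, hmul', Finset.smul_sum]
    refine Finset.sum_congr rfl fun j _ => ?_
    rcases lt_or_ge j c with h | h
    · rw [hx.row a j c h, ← smul_mul_assoc, smul_smul, inv_mul_cancel₀ hq, one_smul]
    · simp [hcol j h]
  · intro a i hi
    rw [hmul, hmul', hmul', Finset.smul_sum, ← Finset.sum_add_distrib]
    refine Finset.sum_congr rfl fun j _ => ?_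
    rcases lt_or_ge j c with h | h
    · rw [← smul_mul_assoc, ← add_mul]
      congr 1
      have h1 := hx.diag i a j c hi h
      have h2 := hx.anti a i j c hi h
      rw [h2]
      linear_combination (norm := module) -h1
    · simp [hcol j h]

/-- The operator that moves the `a`-th entry of the column `c` past the coaction. -/
def braid (κ : K) (x : Fin k → Fin n → S) (e : Fin n → S) (Δ δ : S) (c : Fin n) (a : Fin k) : S :=
  x a c * Δ + κ • (theta x (fun j => if j < c then e j else 0) a * δ)

section Braid

variable {x : Fin k → Fin n → S} {e : Fin n → S} {Δ δ : S} {c : Fin n}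

/-- Together with `braid_mul_theta` this puts both orders of the product into the normal form (⋯)Δ +
κ(⋯)δ, so that they can be compared coefficient by coefficient. -/
theorem theta_mul_braid (hcomm : ∀ i j l, Commute (e l) (x i j)) (κ : K) (i a : Fin k) :
    theta x e i * braid κ x e Δ δ c a
      = (∑ j, x i j * x a c * e j) * Δ
        + κ • ((∑ j, ∑ l, x i j * x a l * (e j * if l < c then e l else 0)) * δ) := by
  rw [braid, mul_add, mul_smul_comm, ← mul_assoc, ← mul_assoc, theta_mul_theta hcomm]
  congr 2
  simp only [theta, Finset.sum_mul, mul_assoc, (hcomm _ _ _).eq]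

/-- Moving Δ and δ past e_j brings in their scalars; the contraction of e_c by δ leaves an extra Δ,
which is why the coefficient of Δ also receives x_aj x_ic for j < c. -/
theorem braid_mul_theta (hcomm : ∀ i j l, Commute (e l) (x i j))
    (hΔx : ∀ i j, Commute Δ (x i j)) (hδx : ∀ i j, Commute δ (x i j))
    (hΔ : ∀ j, Δ * e j = (if j = c then q else 1) • (e j * Δ))
    (hδ : ∀ j, δ * e j = (if j < c then -q⁻¹ else -q) • (e j * δ) + if j = c then Δ else 0)
    (κ : K) (a i : Fin k) :
    braid κ x e Δ δ c a * theta x e i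
      = (∑ j, ((if j = c then q else 1) • (x a c * x i j)
          + (if j < c then κ else 0) • (x a j * x i c)) * e j) * Δ
        + κ • ((∑ j, ∑ l, (if l < c then -q⁻¹ else -q) • (x a j * x i l)
          * ((if j < c then e j else 0) * e l)) * δ) := by
  have h1 : x a c * Δ * theta x e i
      = (∑ j, (if j = c then q else 1) • (x a c * x i j) * e j) * Δ := by
    simp only [theta, Finset.mul_sum, Finset.sum_mul]
    refine Finset.sum_congr rfl fun j _ => ?_
    rw [mul_mul_mul_comm_of_commute (hΔx i j), hΔ, mul_smul_comm, smul_mul_assoc, smul_mul_assoc,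
      mul_assoc _ (e j)]
  have h2 : theta x (fun j => if j < c then e j else 0) a * δ * theta x e i
      = (∑ j, ∑ l, (if l < c then -q⁻¹ else -q) • (x a j * x i l)
          * ((if j < c then e j else 0) * e l)) * δ
        + (∑ j, (if j < c then (1 : K) else 0) • (x a j * x i c) * e j) * Δ := by
    rw [Finset.sum_mul, Finset.sum_mul, ← Finset.sum_add_distrib]
    rw [theta, Finset.sum_mul, Finset.sum_mul]
    refine Finset.sum_congr rfl fun j _ => ?_
    by_cases hj : j < c
    · simp only [hj, if_true, one_smul]
      have h3 : ∀ l, x a j * e j * δ * (x i l * e l)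
          = (if l < c then -q⁻¹ else -q) • (x a j * x i l) * (e j * e l) * δ
            + if l = c then x a j * x i l * (e j * Δ) else 0 := by
        intro l
        have : Commute (e j * δ) (x i l) := (hcomm i l j).mul_left (hδx i l)
        rw [mul_assoc (x a j), mul_mul_mul_comm_of_commute this, mul_assoc (e j), hδ, mul_add,
          mul_add, mul_smul_comm, mul_smul_comm, smul_mul_assoc, smul_mul_assoc]
        congr 1
        · simp only [mul_assoc]
        · split_ifs <;> simp
      simp only [theta, Finset.mul_sum, h3, Finset.sum_add_distrib, Finset.sum_mul]
      simp [mul_assoc]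
    · simp [hj]
  rw [braid, add_mul, h1, smul_mul_assoc, h2, smul_add, ← add_assoc, add_right_comm]
  congr 1
  rw [← smul_mul_assoc, ← add_mul, Finset.smul_sum, ← Finset.sum_add_distrib]
  congr 1
  refine Finset.sum_congr rfl fun j _ => ?_
  rw [add_mul]
  congr 1
  split_ifs <;> simp

/-- The value q - q⁻¹ of κ is what makes the extra Δ-term cancel the defect in the diagonal
relation. In the δ-part, pairs j < l are split by their position relative to c, where both the
truncation and the scalar of δ change. -/
theorem braid_mul_theta_lower (hq : q ≠ 0) (hx : IsQuantumMatrix q x) (he : IsExterior q e)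
    (hcomm : ∀ i j l, Commute (e l) (x i j))
    (hΔx : ∀ i j, Commute Δ (x i j)) (hδx : ∀ i j, Commute δ (x i j))
    (hΔ : ∀ j, Δ * e j = (if j = c then q else 1) • (e j * Δ))
    (hδ : ∀ j, δ * e j = (if j < c then -q⁻¹ else -q) • (e j * δ) + if j = c then Δ else 0)
    (a i : Fin k) (hi : i < a) :
    braid (q - q⁻¹) x e Δ δ c a * theta x e i = theta x e i * braid (q - q⁻¹) x e Δ δ c a := by
  rw [theta_mul_braid hcomm, braid_mul_theta hcomm hΔx hδx hΔ hδ]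
  congr 2
  · refine Finset.sum_congr rfl fun j _ => ?_
    congr 1
    rcases lt_trichotomy j c with h | h | h
    · have h1 := hx.diag i a j c hi h
      have h2 := hx.anti a i j c hi h
      simp only [h, h.ne, if_true, if_false, h2]
      linear_combination (norm := module) -h1
    · subst h
      simp [hx.col i a j hi]
    · simp [h.ne', h.not_gt, hx.anti a i c j hi h]
  · congr 1
    apply sum_sum_eq_of_pairs
    · intro j l h
      rcases lt_or_ge l c with h' | h'
      · simp only [h', h.trans h', if_true]
        rw [pair_eq he h, pair_eq he h]
        congr 1
        have h1 := hx.diag i a j l hi h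
        have h2 := hx.anti a i j l hi h
        rw [h2]
        linear_combination (norm := (match_scalars <;> field_simp <;> ring)) -h1
      · rcases lt_or_ge j c with h'' | h''
        · simp only [h'.not_gt, h'', if_true, if_false, mul_zero, zero_mul, add_zero, zero_add]
          rw [he.swap j l h, hx.anti a i j l hi h]
          simp
        · simp [h'.not_gt, h''.not_gt]
    · intro j
      split_ifs <;> simp [he.sq]

theorem braid_mul_theta_self (hq : q ≠ 0) (hx : IsQuantumMatrix q x) (he : IsExterior q e)
    (hcomm : ∀ i j l, Commute (e l) (x i j))
    (hΔx : ∀ i j, Commute Δ (x i j)) (hδx : ∀ i j, Commute δ (x i j))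
    (hΔ : ∀ j, Δ * e j = (if j = c then q else 1) • (e j * Δ))
    (hδ : ∀ j, δ * e j = (if j < c then -q⁻¹ else -q) • (e j * δ) + if j = c then Δ else 0)
    (a : Fin k) :
    braid (q - q⁻¹) x e Δ δ c a * theta x e a
      = q • (theta x e a * braid (q - q⁻¹) x e Δ δ c a) := by
  rw [theta_mul_braid hcomm, braid_mul_theta hcomm hΔx hδx hΔ hδ, smul_add,
    smul_comm q (q - q⁻¹), ← smul_mul_assoc q _ Δ, ← smul_mul_assoc q _ δ]
  congr 2
  · rw [Finset.smul_sum]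
    refine Finset.sum_congr rfl fun j _ => ?_
    rw [smul_mul_mul q]
    congr 1
    rcases lt_trichotomy j c with h | h | h
    · have h1 := hx.row a j c h
      simp only [h, h.ne, if_true, if_false, h1]
      match_scalars
      field_simp
      ring
    · subst h
      simp
    · simp [h.ne', h.not_gt, hx.row a c j h]
  · congr 1
    simp only [Finset.smul_sum, smul_mul_mul q]
    apply sum_sum_eq_of_pairs
    · intro j l h
      have h1 := hx.row a j l h
      rcases lt_or_ge l c with h' | h'
      · simp only [h', h.trans h', if_true]
        rw [pair_eq he h, pair_eq he h, h1]
        congr 1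
        match_scalars
        field_simp
        ring
      · rcases lt_or_ge j c with h'' | h''
        · simp only [h'.not_gt, h'', if_true, if_false, mul_zero, zero_mul, add_zero, zero_add]
          rw [he.swap j l h, h1]
          simp only [smul_mul_assoc, mul_smul_comm]
        · simp [h'.not_gt, h''.not_gt]
    · intro j
      split_ifs <;> simp [he.sq]

theorem braid_mul_theta_upper (hq : q ≠ 0) (hx : IsQuantumMatrix q x) (he : IsExterior q e)
    (hcomm : ∀ i j l, Commute (e l) (x i j))
    (hΔx : ∀ i j, Commute Δ (x i j)) (hδx : ∀ i j, Commute δ (x i j))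
    (hΔ : ∀ j, Δ * e j = (if j = c then q else 1) • (e j * Δ))
    (hδ : ∀ j, δ * e j = (if j < c then -q⁻¹ else -q) • (e j * δ) + if j = c then Δ else 0)
    (a i : Fin k) (hi : a < i) :
    braid (q - q⁻¹) x e Δ δ c a * theta x e i = theta x e i * braid (q - q⁻¹) x e Δ δ c a
      + (q - q⁻¹) • (theta x e a * braid (q - q⁻¹) x e Δ δ c i) := by
  rw [theta_mul_braid hcomm, theta_mul_braid hcomm, braid_mul_theta hcomm hΔx hδx hΔ hδ, smul_add,
    add_add_add_comm, ← smul_add]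
  congr 2
  · rw [← smul_mul_assoc, ← add_mul, Finset.smul_sum, ← Finset.sum_add_distrib]
    congr 1
    refine Finset.sum_congr rfl fun j _ => ?_
    rw [smul_mul_mul, ← add_mul]
    congr 1
    rcases lt_trichotomy j c with h | h | h
    · simp [h, h.ne, hx.anti i a j c hi h]
    · subst h
      rw [hx.col a i j hi]
      simp only [if_true, lt_irrefl, if_false]
      match_scalars
      field_simp
      ring
    · have h1 := hx.diag a i c j hi h
      have h2 := hx.anti i a c j hi h
      simp only [h.ne', h.not_gt, if_false, zero_smul, add_zero, one_smul]
      linear_combination (norm := module) h1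
  · rw [← smul_mul_assoc, ← add_mul]
    congr 1
    simp only [Finset.smul_sum, ← Finset.sum_add_distrib]
    apply sum_sum_eq_of_pairs
    · intro j l h
      have h1 := hx.diag a i j l hi h
      have h2 := hx.anti i a j l hi h
      rcases lt_or_ge l c with h' | h'
      · simp only [h', h.trans h', if_true]
        rw [smul_mul_mul, smul_mul_mul, ← add_mul, ← add_mul, pair_eq he h, pair_eq he h, h2]
        congr 1
        linear_combination (norm := (match_scalars <;> field_simp <;> ring)) (-q) • h1
      · rcases lt_or_ge j c with h'' | h''
        · simp only [h'.not_gt, h'', if_true, if_false, mul_zero, zero_mul, smul_zero, add_zero,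
            zero_add]
          rw [he.swap j l h, mul_smul_comm, mul_smul_comm, smul_mul_mul (-q), smul_mul_mul (-q),
            ← smul_mul_assoc (q - q⁻¹), ← add_mul]
          congr 1
          linear_combination (norm := module) (-q) • h1
        · simp [h'.not_gt, h''.not_gt]
    · intro j
      split_ifs <;> simp [he.sq]

/-- An entry in one of the columns that are involved, or to the left of them. -/
theorem braid_mul_prod_theta (hq : q ≠ 0) (hx : IsQuantumMatrix q x) (he : IsExterior q e)
    (hcomm : ∀ i j l, Commute (e l) (x i j))
    (hΔx : ∀ i j, Commute Δ (x i j)) (hδx : ∀ i j, Commute δ (x i j))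
    (hΔ : ∀ j, Δ * e j = (if j = c then q else 1) • (e j * Δ))
    (hδ : ∀ j, δ * e j = (if j < c then -q⁻¹ else -q) • (e j * δ) + if j = c then Δ else 0)
    (a : Fin k) :
    braid (q - q⁻¹) x e Δ δ c a * (List.ofFn (theta x e)).prod
      = q • ((List.ofFn (theta x e)).prod * braid (q - q⁻¹) x e Δ δ c a) :=
  mul_prod_theta_of_lower (theta_isExterior hq hx he hcomm)
    (braid_mul_theta_lower hq hx he hcomm hΔx hδx hΔ hδ)
    (braid_mul_theta_self hq hx he hcomm hΔx hδx hΔ hδ)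
    (braid_mul_theta_upper hq hx he hcomm hΔx hδx hΔ hδ) a

end Braid

end Theta

/-! ### Scaling and contraction operators -/

section Contraction

variable {K : Type*} [Field K] (q : K) {n : ℕ} (V : Type*) [AddCommGroup V] [Module K V]

/-- The operator on the quantum exterior algebra that multiplies the generator `c` by `q`. -/
def scaleAt (c : Fin n) : Module.End K (Finset (Fin n) → V) where
  toFun f S := (if c ∈ S then q else 1) • f S
  map_add' f g := by ext S; simp
  map_smul' r f := by ext S; simp [smul_comm r]

/-- The contraction of the quantum exterior algebra with the generator `c`. -/
def contraction (c : Fin n) : Module.End K (Finset (Fin n) → V) where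
  toFun f S := if c ∈ S then 0 else (-q⁻¹) ^ (S.filter (· < c)).card • f (insert c S)
  map_add' f g := by ext S; by_cases h : c ∈ S <;> simp [h]
  map_smul' r f := by
    ext S
    by_cases h : c ∈ S
    · simp [h]
    · simp only [h, if_false, Pi.smul_apply, RingHom.id_apply, smul_comm r]

variable {V}

theorem scaleAt_apply (c : Fin n) (f : Finset (Fin n) → V) (S : Finset (Fin n)) :
    scaleAt q V c f S = (if c ∈ S then q else 1) • f S := rfl

theorem contraction_apply (c : Fin n) (f : Finset (Fin n) → V) (S : Finset (Fin n)) :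
    contraction q V c f S
      = if c ∈ S then 0 else (-q⁻¹) ^ (S.filter (· < c)).card • f (insert c S) := rfl

theorem scaleAt_commute (c : Fin n) (x : Module.End K V) :
    Commute (scaleAt q V c) (coeffwise K n V x) := by
  refine LinearMap.ext fun f => funext fun S => ?_
  by_cases h : c ∈ S <;> simp [scaleAt_apply, h]

theorem contraction_commute (c : Fin n) (x : Module.End K V) :
    Commute (contraction q V c) (coeffwise K n V x) := by
  refine LinearMap.ext fun f => funext fun S => ?_
  by_cases h : c ∈ S <;> simp [contraction_apply, h]

theorem scaleAt_mul_wedge (c j : Fin n) :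
    scaleAt q V c * wedge q V j
      = (if j = c then q else 1) • (wedge q V j * scaleAt q V c) := by
  refine LinearMap.ext fun f => funext fun S => ?_
  by_cases hj : j ∈ S
  · by_cases hc : j = c
    · subst hc
      simp [scaleAt_apply, wedge_apply, hj]
    · have hc' : c ≠ j := fun h => hc h.symm
      simp only [Module.End.mul_apply, scaleAt_apply, wedge_apply, hj, if_true, hc, if_false,
        Finset.mem_erase, hc', ne_eq, not_false_eq_true,
        true_and, one_smul]
      rw [smul_comm]
  · split_ifs <;> simp [scaleAt_apply, wedge_apply, hj]

/-- This is the q-analogue of the Clifford relation. For j = c the factor q in `scaleAt` is what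
cancels the term -q on sets containing c, where contraction after multiplication by e_c is zero. -/
theorem contraction_mul_wedge (hq : q ≠ 0) (c j : Fin n) :
    contraction q V c * wedge q V j
      = (if j < c then -q⁻¹ else -q) • (wedge q V j * contraction q V c)
        + if j = c then scaleAt q V c else 0 := by
  have hinv : ∀ m : ℕ, (-q⁻¹) ^ m * (-q) ^ m = 1 := fun m => by
    rw [← mul_pow, neg_mul_neg, inv_mul_cancel₀ hq, one_pow]
  have hinv' : ∀ m : ℕ, (-q) ^ m * (-q⁻¹) ^ m = 1 := fun m => by
    rw [mul_comm, hinv]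
  refine LinearMap.ext fun f => funext fun S => ?_
  rcases eq_or_ne j c with rfl | hjc
  · simp only [lt_irrefl, if_false, if_true, Module.End.mul_apply, LinearMap.add_apply,
      Pi.add_apply, LinearMap.smul_apply, Pi.smul_apply]
    rw [contraction_apply, wedge_apply, wedge_apply, contraction_apply, scaleAt_apply]
    by_cases hj : j ∈ S
    · simp only [hj, if_true, Finset.mem_erase, ne_eq, not_true, false_and, if_false,
        Finset.insert_erase hj]
      have : (S.erase j).filter (· < j) = S.filter (· < j) := by
        ext a; simp only [Finset.mem_filter, Finset.mem_erase]
        exact ⟨fun h => ⟨h.1.2, h.2⟩, fun h => ⟨⟨h.2.ne, h.1⟩, h.2⟩⟩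
      rw [this, smul_smul ((-q) ^ _), hinv', one_smul, ← add_smul]
      simp
    · have : (insert j S).filter (· < j) = S.filter (· < j) := by
        simp [Finset.filter_insert]
      simp only [hj, if_false, Finset.mem_insert_self, if_true, Finset.erase_insert hj, this,
        smul_smul, hinv, one_smul, smul_zero, zero_add]
  · simp only [hjc, if_false, add_zero, Module.End.mul_apply, LinearMap.smul_apply, Pi.smul_apply]
    rw [contraction_apply, wedge_apply, wedge_apply, contraction_apply]
    by_cases hc : c ∈ S
    · simp [hc, hjc.symm]
    by_cases hj : j ∈ S
    · have he : (insert c S).erase j = insert c (S.erase j) :=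
        Finset.erase_insert_of_ne hjc.symm
      simp only [hc, hj, if_true, if_false, Finset.mem_insert, hjc, false_or, Finset.mem_erase,
        and_false, he, smul_smul]
      congr 1
      rcases lt_or_gt_of_ne hjc with h | h
      · have h1 : (insert c S).filter (· < j) = S.filter (· < j) := by
          rw [Finset.filter_insert, if_neg h.not_gt]
        have h2 : (S.filter (· < c)).card = ((S.erase j).filter (· < c)).card + 1 := by
          have : (S.erase j).filter (· < c) = (S.filter (· < c)).erase j := by
            ext a; simp only [Finset.mem_filter, Finset.mem_erase, and_assoc]
          rw [this, Finset.card_erase_add_one]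
          simp [hj, h]
        rw [h1, h2, if_pos h]
        ring
      · have h1 : ((insert c S).filter (· < j)).card = (S.filter (· < j)).card + 1 := by
          rw [Finset.filter_insert, if_pos h, Finset.card_insert_of_notMem]
          simp [hc]
        have h2 : (S.erase j).filter (· < c) = S.filter (· < c) := by
          ext a; simp only [Finset.mem_filter, Finset.mem_erase]
          exact ⟨fun h' => ⟨h'.1.2, h'.2⟩, fun h' => ⟨⟨(h'.2.trans h).ne, h'.1⟩, h'.2⟩⟩
        rw [h1, h2, if_neg h.not_gt]
        ring
    · simp [hc, hj, hjc]

theorem wedge_isExterior : IsExterior q (wedge (n := n) q V) :=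
  ⟨wedge_mul_self q, fun _ _ h => wedge_mul_of_lt q h⟩

end Contraction

/-! ### Commutation of matrix entries with maximal minors -/

section MinorCommutation

variable {K : Type*} [Field K] {q : K} {V : Type*} [AddCommGroup V] [Module K V] {k n : ℕ}
  {X : Fin k → Fin n → Module.End K V}

/-- The operator identity for `braid` is applied to the vector 1 and read at e_J. The hypothesis on
c covers the cases c ∈ J and c to the left of J, exactly those where the contraction term does not
reach e_J. -/
theorem end_mul_columnMinor (hq : q ≠ 0) (hX : IsQuantumMatrix q X) (J : Finset (Fin n))
    (hJ : J.card = k) (a : Fin k) (c : Fin n) (hc : ∀ j ∈ J, j < c → c ∈ J) :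
    (if c ∈ J then q else 1) • (X a c * columnMinor q X J hJ)
      = q • (columnMinor q X J hJ * X a c) := by
  let x : Fin k → Fin n → Module.End K (Finset (Fin n) → V) :=
    fun i j => coeffwise K n V (X i j)
  let Θ := (List.ofFn (theta x (wedge q V))).prod
  have hΘ : ∀ v, Θ (Pi.single ∅ v) J = columnMinor q X J hJ v := fun v =>
    prod_theta_pi_single q X J hJ v (wedge q V) (fun _ _ => rfl) (fun _ _ => Or.inl rfl)
  have h := braid_mul_prod_theta (c := c) hq (hX.map (coeffwise K n V)) (wedge_isExterior q)
    (fun i j l => wedge_commute q l (X i j)) (fun i j => scaleAt_commute q c (X i j))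
    (fun i j => contraction_commute q c (X i j)) (scaleAt_mul_wedge q c)
    (contraction_mul_wedge q hq c) a
  refine LinearMap.ext fun v => ?_
  have h1 := congrFun (LinearMap.congr_fun h (Pi.single ∅ v)) J
  -- On the vector 1 the contraction vanishes and the scaling is trivial.
  have h2 : braid (q - q⁻¹) x (wedge q V) (scaleAt q V c) (contraction q V c) c a
      (Pi.single ∅ v) = Pi.single ∅ (X a c v) := by
    have h3 : contraction q V c (Pi.single ∅ v) = 0 := by
      funext S
      by_cases hS : c ∈ S
      · simp [contraction_apply, hS]
      · have : insert c S ≠ ∅ := Finset.insert_ne_empty c S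
        simp [contraction_apply, hS, this]
    simp only [braid, LinearMap.add_apply, LinearMap.smul_apply, Module.End.mul_apply, h3, map_zero,
      smul_zero, add_zero]
    funext S
    rw [coeffwise_apply, scaleAt_apply]
    by_cases hS : S = ∅
    · subst hS; simp
    · simp [hS]
  have h4 : ∀ F, braid (q - q⁻¹) x (wedge q V) (scaleAt q V c) (contraction q V c) c a F J
      = (if c ∈ J then q else 1) • X a c (F J) := by
    intro F
    -- Multiplication by e_j reads the contraction at J \ {j}, a set that still contains c, where
    -- the contraction is zero.
    have h5 : theta x (fun j => if j < c then wedge q V j else 0) a (contraction q V c F) J = 0 := by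
      rw [theta, LinearMap.sum_apply, Finset.sum_apply]
      refine Finset.sum_eq_zero fun j _ => ?_
      rw [Module.End.mul_apply, coeffwise_apply]
      by_cases hj : j < c
      · rw [if_pos hj, wedge_apply]
        by_cases hj' : j ∈ J
        · simp [contraction_apply, hj', hj.ne', hc j hj' hj]
        · simp [hj']
      · simp [hj]
    simp only [braid, LinearMap.add_apply, LinearMap.smul_apply, Module.End.mul_apply, Pi.add_apply,
      Pi.smul_apply, h5, smul_zero, add_zero]
    rw [coeffwise_apply, scaleAt_apply, map_smul]
  rw [Module.End.mul_apply, h4, LinearMap.smul_apply, Module.End.mul_apply, h2] at h1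
  change _ • X a c (Θ _ J) = q • Θ _ J at h1
  rw [hΘ, hΘ] at h1
  exact h1

/-- Generators from c on are set to zero: this does not affect the coefficient of e_J, and all
remaining columns then lie to the left of c. -/
theorem end_mul_columnMinor_right (hq : q ≠ 0) (hX : IsQuantumMatrix q X) (J : Finset (Fin n))
    (hJ : J.card = k) (a : Fin k) (c : Fin n) (hc : ∀ j ∈ J, j < c) :
    X a c * columnMinor q X J hJ = q⁻¹ • (columnMinor q X J hJ * X a c) := by
  let x : Fin k → Fin n → Module.End K (Finset (Fin n) → V) :=
    fun i j => coeffwise K n V (X i j)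
  let e : Fin n → Module.End K (Finset (Fin n) → V) := fun j => if j < c then wedge q V j else 0
  have he : IsExterior q e := by
    constructor
    · intro j
      by_cases h : j < c <;> simp [e, h, wedge_mul_self]
    · intro j l hjl
      by_cases h : l < c
      · simp only [e, h, hjl.trans h, if_true, wedge_mul_of_lt q hjl]
      · simp [e, h]
  have hcomm : ∀ i j l, Commute (e l) (x i j) := by
    intro i j l
    by_cases h : l < c
    · simpa only [e, h, if_true] using wedge_commute q l (X i j)
    · simp [e, h]
  have hΘ : ∀ v, (List.ofFn (theta x e)).prod (Pi.single ∅ v) J = columnMinor q X J hJ v := fun v =>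
    prod_theta_pi_single q X J hJ v e (fun j hj => by simp [e, hc j hj])
      (fun j _ => by by_cases h : j < c <;> simp [e, h])
  have h := mul_prod_theta_right hq (hX.map (coeffwise K n V)) he hcomm c
    (fun j hj => by simp [e, hj.not_gt]) a
  refine LinearMap.ext fun v => ?_
  have h1 := congrFun (LinearMap.congr_fun h (Pi.single ∅ v)) J
  have h2 : coeffwise K n V (X a c) (Pi.single ∅ v) = Pi.single ∅ (X a c v) := by
    funext S
    rw [coeffwise_apply]
    by_cases hS : S = ∅
    · subst hS; simp
    · simp [hS]
  rw [Module.End.mul_apply, LinearMap.smul_apply, Module.End.mul_apply, h2, coeffwise_apply] at h1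
  change X a c ((List.ofFn (theta x e)).prod _ J) = q⁻¹ • (List.ofFn (theta x e)).prod _ J at h1
  rw [hΘ, hΘ] at h1
  exact h1

variable {A : Type*} [Ring A] [Algebra K A] {x : Fin k → Fin n → A}

/-- The operator statement is transported along the left regular representation, which is faithful.
-/
theorem IsQuantumMatrix.mul_columnMinor_of_mem (hq : q ≠ 0) (hx : IsQuantumMatrix q x)
    (J : Finset (Fin n)) (hJ : J.card = k) (a : Fin k) (c : Fin n) (hc : c ∈ J) :
    x a c * columnMinor q x J hJ = columnMinor q x J hJ * x a c := by
  have h := end_mul_columnMinor hq (hx.map (Algebra.lmul K A)) J hJ a c (fun _ _ _ => hc)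
  rw [if_pos hc, ← map_columnMinor, ← map_mul, ← map_mul, ← map_smul, ← map_smul] at h
  have := Algebra.lmul_injective h
  exact (smul_right_injective A hq) this

theorem IsQuantumMatrix.mul_columnMinor_of_lt (hq : q ≠ 0) (hx : IsQuantumMatrix q x)
    (J : Finset (Fin n)) (hJ : J.card = k) (a : Fin k) (c : Fin n) (hc : ∀ j ∈ J, c < j) :
    x a c * columnMinor q x J hJ = q • (columnMinor q x J hJ * x a c) := by
  have h := end_mul_columnMinor hq (hx.map (Algebra.lmul K A)) J hJ a c
    (fun j hj h => absurd h (hc j hj).not_gt)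
  rw [if_neg fun h => (hc c h).false, one_smul, ← map_columnMinor, ← map_mul, ← map_mul,
    ← map_smul] at h
  exact Algebra.lmul_injective h

theorem IsQuantumMatrix.columnMinor_mul_of_lt (hq : q ≠ 0) (hx : IsQuantumMatrix q x)
    (J : Finset (Fin n)) (hJ : J.card = k) (a : Fin k) (c : Fin n) (hc : ∀ j ∈ J, j < c) :
    columnMinor q x J hJ * x a c = q • (x a c * columnMinor q x J hJ) := by
  have h := end_mul_columnMinor_right hq (hx.map (Algebra.lmul K A)) J hJ a c hc
  rw [← map_columnMinor, ← map_mul, ← map_mul, ← map_smul] at h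
  rw [Algebra.lmul_injective h, smul_smul, mul_inv_cancel₀ hq, one_smul]

theorem mul_list_prod_of_qcommute {y : A} (s : K) {p : Fin n → Prop} [DecidablePred p] :
    ∀ {t : ℕ} (z : Fin t → A) (c : Fin t → Fin n),
      (∀ i, y * z i = (if p (c i) then s else 1) • (z i * y)) →
      y * (List.ofFn z).prod
        = s ^ (Finset.univ.filter fun i => p (c i)).card • ((List.ofFn z).prod * y)
  | 0, _, _, _ => by simp
  | t + 1, z, c, h => by
    have ih := mul_list_prod_of_qcommute s (fun i : Fin t => z i.succ) (fun i => c i.succ)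
      (fun i => h _)
    have h1 : (Finset.univ.filter fun i => p (c i)).card
        = (if p (c 0) then 1 else 0) + (Finset.univ.filter fun i : Fin t => p (c i.succ)).card := by
      simp only [Finset.card_filter, Fin.sum_univ_succ]
    rw [List.ofFn_succ, List.prod_cons, ← mul_assoc, h 0, smul_mul_assoc, mul_assoc, ih, h1, pow_add,
      mul_smul_comm, smul_smul, mul_assoc]
    congr 2
    split_ifs <;> simp

/-- Every term of the minor uses each column of J once, so all terms collect the same power of s. -/
theorem mul_columnMinor_of_qcommute {y : A} (s : K) {p : Fin n → Prop} [DecidablePred p]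
    (h : ∀ i c, y * x i c = (if p c then s else 1) • (x i c * y)) (J : Finset (Fin n))
    (hJ : J.card = k) :
    y * columnMinor q x J hJ = s ^ (J.filter p).card • (columnMinor q x J hJ * y) := by
  rw [columnMinor, quantumDet, Finset.mul_sum, Finset.sum_mul, Finset.smul_sum]
  refine Finset.sum_congr rfl fun σ _ => ?_
  have h1 : (Finset.univ.filter fun i => p (J.orderEmbOfFin hJ (σ i))).card
      = (J.filter p).card := by
    have h2 : J.filter p
        = (Finset.univ.filter fun i => p (J.orderEmbOfFin hJ (σ i))).image
          fun i => J.orderEmbOfFin hJ (σ i) := by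
      rw [← Finset.filter_image]
      congr 1
      have h := Finset.image_image (s := Finset.univ) (f := σ) (g := J.orderEmbOfFin hJ)
      rw [Finset.image_univ_equiv, Finset.image_orderEmbOfFin_univ] at h
      exact h
    rw [h2, Finset.card_image_of_injective]
    exact (J.orderEmbOfFin hJ).injective.comp σ.injective
  rw [mul_smul_comm, mul_list_prod_of_qcommute s (p := p) _ (fun i => J.orderEmbOfFin hJ (σ i))
    (fun i => h _ _), h1, smul_mul_assoc, smul_comm]

theorem columnMinor_mul_of_qcommute {y : A} {p : Fin n → Prop} [DecidablePred p] (hq : q ≠ 0)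
    (h : ∀ i c, x i c * y = (if p c then q else 1) • (y * x i c)) (J : Finset (Fin n))
    (hJ : J.card = k) :
    columnMinor q x J hJ * y = q ^ (J.filter p).card • (y * columnMinor q x J hJ) := by
  have h1 : ∀ i c, y * x i c = (if p c then q⁻¹ else 1) • (x i c * y) := by
    intro i c
    rw [h, smul_smul]
    split_ifs
    · rw [inv_mul_cancel₀ hq, one_smul]
    · simp
  rw [mul_columnMinor_of_qcommute q⁻¹ h1, smul_smul, ← mul_pow, mul_inv_cancel₀ hq, one_pow,
    one_smul]

end MinorCommutation

/-! ### The two extreme Plücker coordinates q-commute with all others -/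

section Plucker

variable {K : Type*} [Field K] {q : K} {k n : ℕ}

/-- [u] commutes with the entries in its own columns and q-commutes with those to the right. -/
theorem u_mul_plucker (hq : q ≠ 0) (h : k ≤ n) (J : Finset (Fin n)) (hJ : J.card = k) :
    QGrass.u q h * plucker q J hJ
      = q ^ (J.filter fun c => k ≤ c.val).card • (plucker q J hJ * QGrass.u q h) := by
  apply Subtype.ext
  refine mul_columnMinor_of_qcommute q (p := fun c : Fin n => k ≤ c.val) ?_ J hJ
  intro i c
  by_cases hc : k ≤ c.val
  · rw [if_pos hc]
    refine (QMat.isQuantumMatrix q k n).columnMinor_mul_of_lt hq _ _ i c fun j hj => ?_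
    simp only [uSet, Finset.mem_filter, Finset.mem_univ, true_and] at hj
    exact Fin.lt_def.2 (by omega)
  · rw [if_neg hc, one_smul]
    refine ((QMat.isQuantumMatrix q k n).mul_columnMinor_of_mem hq _ _ i c ?_).symm
    simp only [uSet, Finset.mem_filter, Finset.mem_univ, true_and]
    omega

/-- The mirror image: entries in the columns of [w] commute with it, entries to the left q-commute.
-/
theorem plucker_mul_w (hq : q ≠ 0) (h : k ≤ n) (J : Finset (Fin n)) (hJ : J.card = k) :
    plucker q J hJ * QGrass.w q h
      = q ^ (J.filter fun c => c.val + k < n).card • (QGrass.w q h * plucker q J hJ) := by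
  apply Subtype.ext
  refine columnMinor_mul_of_qcommute (p := fun c : Fin n => c.val + k < n) hq ?_ J hJ
  intro i c
  by_cases hc : c.val + k < n
  · rw [if_pos hc]
    refine (QMat.isQuantumMatrix q k n).mul_columnMinor_of_lt hq _ _ i c fun j hj => ?_
    simp only [wSet, Finset.mem_filter, Finset.mem_univ, true_and] at hj
    exact Fin.lt_def.2 (by omega)
  · rw [if_neg hc, one_smul]
    refine (QMat.isQuantumMatrix q k n).mul_columnMinor_of_mem hq _ _ i c ?_
    simp only [wSet, Finset.mem_filter, Finset.mem_univ, true_and]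
    omega

end Plucker

/-! ### Multiplying a quantum matrix by a triangular block -/

section ColumnStep

variable {K : Type*} [Field K] {q : K} {S : Type*} [Ring S] [Algebra K S] {k n : ℕ}

/-- The relations between the entries of two columns of a quantum matrix, the first one to the
left of the second one. -/
structure ColumnRel (q : K) (ξ η : Fin k → S) : Prop where
  row : ∀ i, ξ i * η i = q • (η i * ξ i)
  anti : ∀ i l, l < i → ξ i * η l = η l * ξ i
  diag : ∀ i l, i < l → ξ i * η l - η l * ξ i = (q - q⁻¹) • (η i * ξ l)

theorem IsQuantumMatrix.columnRel {x : Fin k → Fin n → S} (hx : IsQuantumMatrix q x) {j l : Fin n}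
    (h : j < l) : ColumnRel q (fun i => x i j) (fun i => x i l) :=
  ⟨fun i => hx.row i j l h, fun i i' hi => hx.anti i i' j l hi h,
    fun i i' hi => hx.diag i i' j l hi h⟩

theorem IsQuantumMatrix.of_columnRel {x : Fin k → Fin n → S}
    (hcol : ∀ (i l : Fin k) (j : Fin n), i < l → x i j * x l j = q • (x l j * x i j))
    (h : ∀ j l, j < l → ColumnRel q (fun i => x i j) (fun i => x i l)) : IsQuantumMatrix q x :=
  ⟨fun i j l hjl => (h j l hjl).row i, hcol, fun i i' j l hi hjl => (h j l hjl).anti i i' hi,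
    fun i i' j l hi hjl => (h j l hjl).diag i i' hi⟩

theorem ColumnRel.mul_left {ξ η : Fin k → S} (h : ColumnRel q ξ η) {a : S}
    (ha : ∀ i, Commute a (η i)) : ColumnRel q (fun i => ξ i * a) η := by
  have h1 : ∀ i l, ξ i * a * η l = ξ i * η l * a := fun i l => by
    rw [mul_assoc, (ha l).eq, mul_assoc]
  refine ⟨fun i => ?_, fun i l hi => ?_, fun i l hi => ?_⟩
  · rw [h1, h.row, smul_mul_assoc, mul_assoc]
  · rw [h1, h.anti i l hi, mul_assoc]
  · rw [h1, ← mul_assoc, ← sub_mul, h.diag i l hi, smul_mul_assoc, mul_assoc]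

theorem ColumnRel.mul_right {ξ η : Fin k → S} (h : ColumnRel q ξ η) {a : S}
    (ha : ∀ i, Commute a (ξ i)) : ColumnRel q ξ (fun i => η i * a) := by
  have h1 : ∀ i l, η i * a * ξ l = η i * ξ l * a := fun i l => by
    rw [mul_assoc, (ha l).eq, mul_assoc]
  refine ⟨fun i => ?_, fun i l hi => ?_, fun i l hi => ?_⟩
  · rw [h1, ← mul_assoc, h.row, smul_mul_assoc]
  · rw [h1, ← mul_assoc, h.anti i l hi]
  · rw [h1, h1, ← mul_assoc, ← sub_mul, h.diag i l hi, smul_mul_assoc]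

theorem ColumnRel.add_left {ξ ξ' η : Fin k → S} (h : ColumnRel q ξ η) (h' : ColumnRel q ξ' η) :
    ColumnRel q (fun i => ξ i + ξ' i) η := by
  refine ⟨fun i => ?_, fun i l hi => ?_, fun i l hi => ?_⟩
  · rw [add_mul, h.row, h'.row, mul_add, smul_add]
  · rw [add_mul, h.anti i l hi, h'.anti i l hi, mul_add]
  · rw [add_mul, mul_add, mul_add, smul_add, ← h.diag i l hi, ← h'.diag i l hi]
    abel

theorem ColumnRel.add_right {ξ η η' : Fin k → S} (h : ColumnRel q ξ η) (h' : ColumnRel q ξ η') :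
    ColumnRel q ξ (fun i => η i + η' i) := by
  refine ⟨fun i => ?_, fun i l hi => ?_, fun i l hi => ?_⟩
  · rw [mul_add, h.row, h'.row, add_mul, smul_add]
  · rw [add_mul, mul_add, h.anti i l hi, h'.anti i l hi]
  · rw [add_mul, add_mul, mul_add, smul_add, ← h.diag i l hi, ← h'.diag i l hi]
    abel

/-- Two multiples of the same column. -/
theorem ColumnRel.of_col (hq : q ≠ 0) {ξ : Fin k → S}
    (hξ : ∀ i l, i < l → ξ i * ξ l = q • (ξ l * ξ i))
    {a b : S} (ha : ∀ i, Commute a (ξ i)) (hb : ∀ i, Commute b (ξ i)) (hab : a * b = q • (b * a)) :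
    ColumnRel q (fun i => ξ i * a) (fun i => ξ i * b) := by
  have h1 : ∀ i l, ξ i * a * (ξ l * b) = q • (ξ i * ξ l * (b * a)) := fun i l => by
    rw [mul_mul_mul_comm_of_commute (ha l), hab, mul_smul_comm]
  have h2 : ∀ i l, ξ i * b * (ξ l * a) = ξ i * ξ l * (b * a) := fun i l =>
    mul_mul_mul_comm_of_commute (hb l)
  refine ⟨fun i => ?_, fun i l hi => ?_, fun i l hi => ?_⟩
  · rw [h1, h2]
  · rw [h1, h2, hξ l i hi, smul_mul_assoc]
  · rw [h1, h2, h2, hξ i l hi, smul_mul_assoc]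
    match_scalars
    field_simp

/-- The only delicate terms are the mixed ones: the defect (q - q⁻¹) of the diagonal relation
between ξ and η is balanced by the factor q in bd = q db. -/
theorem ColumnRel.col_add (hq : q ≠ 0) {ξ η : Fin k → S} (h : ColumnRel q ξ η)
    (hξ : ∀ i l, i < l → ξ i * ξ l = q • (ξ l * ξ i))
    (hη : ∀ i l, i < l → η i * η l = q • (η l * η i)) {b d : S}
    (hbξ : ∀ i, Commute b (ξ i)) (hbη : ∀ i, Commute b (η i))
    (hdξ : ∀ i, Commute d (ξ i)) (hdη : ∀ i, Commute d (η i)) (hbd : b * d = q • (d * b))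
    (i l : Fin k) (hi : i < l) :
    (ξ i * b + η i * d) * (ξ l * b + η l * d)
      = q • ((ξ l * b + η l * d) * (ξ i * b + η i * d)) := by
  simp only [add_mul, mul_add, mul_mul_mul_comm_of_commute (hbξ _),
    mul_mul_mul_comm_of_commute (hbη _), mul_mul_mul_comm_of_commute (hdξ _),
    mul_mul_mul_comm_of_commute (hdη _), hbd, hξ i l hi, hη i l hi, h.anti l i hi]
  have h1 : ξ i * η l = η l * ξ i + (q - q⁻¹) • (η i * ξ l) := by
    rw [← h.diag i l hi]; abel
  rw [h1]
  simp only [add_mul, smul_mul_assoc, mul_smul_comm]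
  match_scalars <;> field_simp
  ring

/-- Multiplication of a quantum matrix by an upper triangular block in two adjacent columns. -/
def columnStep (x : Fin k → Fin n → S) (a b d : S) (c c' : Fin n) (i : Fin k) (j : Fin n) : S :=
  if j = c then x i c * a else if j = c' then x i c * b + x i c' * d else x i j

/-- The block with rows (a, b) and (0, d) is itself a quantum matrix whose entries commute with `x`;
a product of two such matrices satisfies the relations again. Only two columns change, so they are
checked pairwise. -/
theorem IsQuantumMatrix.columnStep (hq : q ≠ 0) {x : Fin k → Fin n → S} (hx : IsQuantumMatrix q x)
    {a b d : S} {c c' : Fin n} (hc : c'.val = c.val + 1) (ha : ∀ i j, Commute a (x i j))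
    (hb : ∀ i j, Commute b (x i j)) (hd : ∀ i j, Commute d (x i j)) (hab : a * b = q • (b * a))
    (hbd : b * d = q • (d * b)) (had : Commute a d) :
    IsQuantumMatrix q (columnStep x a b d c c') := by
  have hlt : c < c' := Fin.lt_def.2 (by omega)
  have hne : c' ≠ c := hlt.ne'
  have hca : (fun i => _root_.columnStep x a b d c c' i c) = fun i => x i c * a := by
    funext i; simp [_root_.columnStep]
  have hcb : (fun i => _root_.columnStep x a b d c c' i c')
      = fun i => x i c * b + x i c' * d := by
    funext i; simp [_root_.columnStep, hne]
  have hco : ∀ j, j ≠ c → j ≠ c' →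
      (fun i => _root_.columnStep x a b d c c' i j) = fun i => x i j := by
    intro j h1 h2; funext i; simp [_root_.columnStep, h1, h2]
  apply IsQuantumMatrix.of_columnRel
  · intro i l j hi
    by_cases h1 : j = c
    · subst h1
      rw [congrFun hca i, congrFun hca l, mul_mul_mul_comm_of_commute (ha _ _),
        mul_mul_mul_comm_of_commute (ha _ _), hx.col i l j hi, smul_mul_assoc]
    by_cases h2 : j = c'
    · subst h2
      rw [congrFun hcb i, congrFun hcb l]
      exact (hx.columnRel hlt).col_add hq (fun i l => hx.col i l _) (fun i l => hx.col i l _)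
        (fun i => hb i _) (fun i => hb i _) (fun i => hd i _) (fun i => hd i _) hbd i l hi
    · rw [congrFun (hco j h1 h2) i, congrFun (hco j h1 h2) l, hx.col i l j hi]
  · intro j l hjl
    by_cases h1 : j = c
    · subst h1
      rw [hca]
      by_cases h2 : l = c'
      · subst h2
        rw [hcb]
        refine ColumnRel.add_right (ColumnRel.of_col hq (fun i l => hx.col i l _)
          (fun i => ha i _) (fun i => hb i _) hab) ?_
        exact ((hx.columnRel hlt).mul_right fun i => hd i _).mul_left
          fun i => (ha i _).mul_right had
      · rw [hco l hjl.ne' h2]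
        exact (hx.columnRel hjl).mul_left fun i => ha i _
    by_cases h2 : j = c'
    · subst h2
      rw [hcb, hco l (hlt.trans hjl).ne' hjl.ne']
      exact ((hx.columnRel (hlt.trans hjl)).mul_left fun i => hb i _).add_left
        ((hx.columnRel hjl).mul_left fun i => hd i _)
    rw [hco j h1 h2]
    by_cases h3 : l = c
    · subst h3
      rw [hca]
      exact (hx.columnRel hjl).mul_right fun i => ha i _
    by_cases h4 : l = c'
    · subst h4
      -- Adjacency of c and c' enters here: a column left of c' and different from c is left of c as
      -- well.
      have hjc : j < c := by
        rw [Fin.lt_def] at hjl ⊢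
        have : j.val ≠ c.val := fun h => h1 (Fin.ext h)
        omega
      rw [hcb]
      exact ((hx.columnRel hjc).mul_right fun i => hb i _).add_right
        ((hx.columnRel hjl).mul_right fun i => hd i _)
    · rw [hco l h3 h4]
      exact hx.columnRel hjl

end ColumnStep

/-! ### The effect of a triangular block on the minors -/

section ColumnStepMinors

variable {K : Type*} [Field K] {q : K} {V : Type*} [AddCommGroup V] [Module K V] {k n : ℕ}

/-- The action on the quantum exterior algebra of an upper triangular block in two adjacent
columns. -/
def exteriorStep (a b d : Module.End K V) (c c' : Fin n) : Module.End K (Finset (Fin n) → V) where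
  toFun f S :=
    if c ∈ S then (if c' ∈ S then f S else a (f S))
    else if c' ∈ S then d (f S) + b (f (insert c (S.erase c'))) else f S
  map_add' f g := by
    ext S; by_cases h : c ∈ S <;> by_cases h' : c' ∈ S <;> simp [h, h']
    abel
  map_smul' r f := by
    ext S; by_cases h : c ∈ S <;> by_cases h' : c' ∈ S <;> simp [h, h']

theorem exteriorStep_apply (a b d : Module.End K V) (c c' : Fin n) (f : Finset (Fin n) → V)
    (S : Finset (Fin n)) :
    exteriorStep a b d c c' f S
      = if c ∈ S then (if c' ∈ S then f S else a (f S))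
        else if c' ∈ S then d (f S) + b (f (insert c (S.erase c'))) else f S := rfl

theorem exteriorStep_commute {a b d x : Module.End K V} (ha : Commute a x) (hb : Commute b x)
    (hd : Commute d x) (c c' : Fin n) :
    Commute (exteriorStep a b d c c') (coeffwise K n V x) := by
  have ha' : ∀ v, a (x v) = x (a v) := fun v => LinearMap.congr_fun ha.eq v
  have hb' : ∀ v, b (x v) = x (b v) := fun v => LinearMap.congr_fun hb.eq v
  have hd' : ∀ v, d (x v) = x (d v) := fun v => LinearMap.congr_fun hd.eq v
  refine LinearMap.ext fun f => funext fun S => ?_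
  by_cases h : c ∈ S <;> by_cases h' : c' ∈ S <;>
    simp [exteriorStep_apply, h, h', ha', hb', hd']

/-- No index lies strictly between c and c', so exchanging them leaves the sign exponents of the
other generators unchanged. -/
theorem filter_lt_exchange {c c' j : Fin n} (hc : c'.val = c.val + 1) {S : Finset (Fin n)}
    (h : c ∉ S) (h' : c' ∈ S) (hj : j ≠ c') :
    ((insert c (S.erase c')).filter (· < j)).card = (S.filter (· < j)).card := by
  have hlt : c < c' := Fin.lt_def.2 (by omega)
  rw [Finset.filter_insert, Finset.filter_erase]
  by_cases hcj : c < j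
  · have hc'j : c' < j := by
      rw [Fin.lt_def] at hcj ⊢
      have : j.val ≠ c'.val := fun h => hj (Fin.ext h)
      omega
    rw [if_pos hcj, Finset.card_insert_of_notMem, Finset.card_erase_add_one]
    · simp [h', hc'j]
    · simp [h]
  · rw [if_neg hcj, Finset.erase_eq_of_notMem]
    simp only [Finset.mem_filter, not_and]
    intro _ h2
    exact hcj (hlt.trans h2)

theorem filter_lt_next {c c' : Fin n} (hc : c'.val = c.val + 1) (S : Finset (Fin n)) :
    (S.filter (· < c')).card = (S.filter (· < c)).card + if c ∈ S then 1 else 0 := by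
  by_cases h : c ∈ S
  · have : S.filter (· < c') = insert c (S.filter (· < c)) := by
      ext a
      simp only [Finset.mem_filter, Finset.mem_insert, Fin.lt_def, Fin.ext_iff]
      constructor
      · rintro ⟨h1, h2⟩
        by_cases h3 : a.val = c.val
        · exact Or.inl h3
        · exact Or.inr ⟨h1, by omega⟩
      · rintro (h1 | ⟨h1, h2⟩)
        · exact ⟨(Fin.ext h1 : a = c) ▸ h, by omega⟩
        · exact ⟨h1, by omega⟩
    rw [this, Finset.card_insert_of_notMem (by simp), if_pos h]
  · rw [if_neg h, add_zero]
    congr 1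
    ext a
    simp only [Finset.mem_filter, Fin.lt_def]
    refine and_congr_right fun ha => ?_
    have : a.val ≠ c.val := fun h3 => h ((Fin.ext h3 : a = c) ▸ ha)
    omega

theorem wedge_mul_exteriorStep_of_ne (a b d : Module.End K V) {c c' j : Fin n}
    (hc : c'.val = c.val + 1) (h1 : j ≠ c) (h2 : j ≠ c') :
    wedge q V j * exteriorStep a b d c c' = exteriorStep a b d c c' * wedge q V j := by
  refine LinearMap.ext fun f => funext fun S => ?_
  rw [Module.End.mul_apply, Module.End.mul_apply, wedge_apply, exteriorStep_apply,
    exteriorStep_apply]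
  by_cases hj : j ∈ S
  · by_cases h : c ∈ S <;> by_cases h' : c' ∈ S
    · simp [hj, h, h', h1.symm, h2.symm, wedge_apply]
    · simp [hj, h, h', h1.symm, wedge_apply]
    · have he : (insert c (S.erase c')).erase j = insert c ((S.erase j).erase c') := by
        rw [Finset.erase_insert_of_ne h1.symm, Finset.erase_right_comm]
      simp [hj, h, h', h2, h2.symm, wedge_apply, filter_lt_exchange hc h h' h2, he]
    · simp [hj, h, h', wedge_apply]
  · by_cases h : c ∈ S <;> by_cases h' : c' ∈ S <;> simp [hj, h, h', h1, wedge_apply]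

theorem wedge_mul_exteriorStep_right (a b d : Module.End K V) {c c' : Fin n}
    (hc : c'.val = c.val + 1) (had : d * a = 1) :
    coeffwise K n V d * wedge q V c' * exteriorStep a b d c c'
      = exteriorStep a b d c c' * wedge q V c' := by
  have had' : ∀ v, d (a v) = v := fun v => LinearMap.congr_fun had v
  have hne : c ≠ c' := fun h => by rw [h] at hc; omega
  refine LinearMap.ext fun f => funext fun S => ?_
  rw [Module.End.mul_apply, Module.End.mul_apply, Module.End.mul_apply, coeffwise_apply,
    wedge_apply, exteriorStep_apply, exteriorStep_apply]
  by_cases h : c ∈ S <;> by_cases h' : c' ∈ S <;>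
    simp [h, h', wedge_apply, hne, hne.symm, had']

/-- The generator e_c becomes a e_c + b e_c'. If S contains both indices, the two b-terms must
cancel, which is where ab = q ba is used; the block has quantum determinant ad = 1, so e_c e_c' is
unchanged. -/
theorem wedge_mul_exteriorStep_left {a b d : Module.End K V} {c c' : Fin n}
    (hc : c'.val = c.val + 1) (had : a * d = 1) (hab : a * b = q • (b * a)) :
    (coeffwise K n V a * wedge q V c + coeffwise K n V b * wedge q V c') * exteriorStep a b d c c'
      = exteriorStep a b d c c' * wedge q V c := by
  have had' : ∀ v, a (d v) = v := fun v => LinearMap.congr_fun had v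
  have hab' : ∀ v, a (b v) = q • b (a v) := fun v => LinearMap.congr_fun hab v
  have hne : c ≠ c' := fun h => by rw [h] at hc; omega
  refine LinearMap.ext fun f => funext fun S => ?_
  rw [Module.End.mul_apply, Module.End.mul_apply, LinearMap.add_apply, Pi.add_apply,
    Module.End.mul_apply, Module.End.mul_apply, coeffwise_apply, coeffwise_apply,
    wedge_apply, wedge_apply, exteriorStep_apply, exteriorStep_apply, exteriorStep_apply]
  by_cases h : c ∈ S <;> by_cases h' : c' ∈ S
  · have he : insert c ((S.erase c).erase c') = S.erase c' := by
      rw [Finset.erase_right_comm, Finset.insert_erase]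
      simp [h, hne]
    simp [h, h', wedge_apply, hne, hne.symm, had', hab', he, filter_lt_next hc S, pow_succ]
    rw [smul_smul, add_neg_cancel_right]
  · simp [h, h', wedge_apply]
  · simp [h, h', wedge_apply, hne, filter_lt_exchange hc h h' hne, filter_lt_next hc S]
  · simp [h, h', wedge_apply]

/-- The minors of a quantum matrix after multiplication by an upper triangular block in two
adjacent columns. -/
theorem columnMinor_columnStep {X : Fin k → Fin n → Module.End K V} {a b d : Module.End K V}
    {c c' : Fin n} (hc : c'.val = c.val + 1) (ha : ∀ i j, Commute a (X i j))
    (hb : ∀ i j, Commute b (X i j)) (hd : ∀ i j, Commute d (X i j)) (hab : a * b = q • (b * a))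
    (had : a * d = 1) (hda : d * a = 1) (J : Finset (Fin n)) (hJ : J.card = k) (v : V) :
    columnMinor q (columnStep X a b d c c') J hJ v
      = exteriorStep a b d c c'
        (fun S => if hS : S.card = k then columnMinor q X S hS v else 0) J := by
  have hne : c ≠ c' := fun h => by rw [h] at hc; omega
  let x : Fin k → Fin n → Module.End K (Finset (Fin n) → V) :=
    fun i j => coeffwise K n V (X i j)
  let x' : Fin k → Fin n → Module.End K (Finset (Fin n) → V) :=
    fun i j => coeffwise K n V (columnStep X a b d c c' i j)
  let g := exteriorStep a b d c c'
  -- The block is moved from the matrix to the generators: ∑ (X·block)_ij e_j = ∑ X_ij e'_j, and `g`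
  -- intertwines the `e'` with the original generators.
  let e' : Fin n → Module.End K (Finset (Fin n) → V) := fun j =>
    if j = c then coeffwise K n V a * wedge q V c + coeffwise K n V b * wedge q V c'
    else if j = c' then coeffwise K n V d * wedge q V c' else wedge q V j
  have he' : ∀ j, e' j * g = g * wedge q V j := by
    intro j
    by_cases h1 : j = c
    · subst h1
      simp only [e', if_true]
      exact wedge_mul_exteriorStep_left hc had hab
    by_cases h2 : j = c'
    · subst h2
      simp only [e', h1, if_true, if_false]
      exact wedge_mul_exteriorStep_right a b d hc hda
    · simp only [e', h1, h2, if_false]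
      exact wedge_mul_exteriorStep_of_ne a b d hc h1 h2
  have hθ : ∀ i, theta x' (wedge q V) i = theta x e' i := by
    intro i
    rw [← sub_eq_zero, theta, theta, ← Finset.sum_sub_distrib, Fintype.sum_eq_add c c' hne]
    · simp only [x, x', e', columnStep, if_true, hne.symm, if_false, map_mul, map_add, add_mul,
        mul_add, mul_assoc]
      abel
    · rintro j ⟨h1, h2⟩
      simp [x, x', e', columnStep, h1, h2]
  have hg : ∀ i, theta x' (wedge q V) i * g = g * theta x (wedge q V) i := by
    intro i
    rw [hθ, theta, theta, Finset.sum_mul, Finset.mul_sum]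
    refine Finset.sum_congr rfl fun j _ => ?_
    have h1 : Commute g (x i j) := exteriorStep_commute (ha i j) (hb i j) (hd i j) c c'
    rw [mul_assoc, he', ← mul_assoc, ← h1.eq, mul_assoc]
  have hprod : ∀ l : List (Fin k), (l.map (theta x' (wedge q V))).prod * g
      = g * (l.map (theta x (wedge q V))).prod := by
    intro l
    induction l with
    | nil => simp
    | cons i l ih => rw [List.map_cons, List.prod_cons, mul_assoc, ih, ← mul_assoc, hg,
        List.map_cons, List.prod_cons, mul_assoc]
  -- As `g` fixes the vector 1, the new product applied to 1 is `g` of the old one, and the new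
  -- minors are its coefficients.
  have hfix : g (Pi.single ∅ v) = Pi.single ∅ v := by
    funext S
    rw [exteriorStep_apply]
    by_cases hS : S = ∅
    · subst hS; simp
    · simp [hS]
  have h1 := prod_theta_pi_single q (columnStep X a b d c c') J hJ v (wedge q V)
    (fun _ _ => rfl) (fun _ _ => Or.inl rfl)
  have h2 : (List.ofFn (theta x' (wedge q V))).prod (Pi.single ∅ v)
      = g ((List.ofFn (theta x (wedge q V))).prod (Pi.single ∅ v)) := by
    have h := LinearMap.congr_fun (hprod (List.finRange k)) (Pi.single ∅ v)
    rw [Module.End.mul_apply, Module.End.mul_apply, hfix] at h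
    simpa only [List.ofFn_eq_map] using h
  have h3 : ∀ S (hS : S.card = k), (List.ofFn (theta x (wedge q V))).prod (Pi.single ∅ v) S
      = columnMinor q X S hS v := fun S hS =>
    prod_theta_pi_single q X S hS v (wedge q V) (fun _ _ => rfl) (fun _ _ => Or.inl rfl)
  rw [← h1]
  change (List.ofFn (theta x' (wedge q V))).prod (Pi.single ∅ v) J = _
  rw [h2, exteriorStep_apply, exteriorStep_apply, dif_pos hJ, h3 J hJ]
  by_cases h4 : c ∈ J
  · simp [h4]
  by_cases h5 : c' ∈ J
  · have h6 : (insert c (J.erase c')).card = k := by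
      rw [Finset.card_insert_of_notMem (by simp [h4]), Finset.card_erase_add_one h5, hJ]
    rw [h3 _ h6, dif_pos h6]
  · simp [h4, h5]

end ColumnStepMinors

/-! ### A quantum torus acting on finitely supported sequences -/

section QuantumTorus

variable {K : Type*} [Field K] (q : K) (V : Type*) [AddCommGroup V] [Module K V]

/-- The coefficientwise action of an endomorphism on finitely supported functions. -/
noncomputable def finsuppEnd : Module.End K V →ₐ[K] Module.End K (ℤ →₀ V) where
  toFun x := Finsupp.mapRange.linearMap x
  map_one' := by ext; simp
  map_zero' := by ext; simp
  map_mul' _ _ := by ext; simp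
  map_add' _ _ := by ext; simp
  commutes' _ := by ext; simp [Algebra.algebraMap_eq_smul_one]

variable {V} in
@[simp]
theorem finsuppEnd_apply (x : Module.End K V) (f : ℤ →₀ V) (m : ℤ) :
    finsuppEnd V x f m = x (f m) := rfl

/-- Multiplication of the value at `m` by `t ^ m`. -/
noncomputable def torusScale (t : K) : Module.End K (ℤ →₀ V) where
  toFun f := Finsupp.onFinset f.support (fun m => t ^ m • f m) fun m h => by
    rw [Finsupp.mem_support_iff]
    rintro h'
    simp [h'] at h
  map_add' f g := by ext; simp
  map_smul' r f := by ext; simp [smul_comm r]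

/-- The shift by one. -/
noncomputable def torusShift : Module.End K (ℤ →₀ V) :=
  (Finsupp.domLCongr (Equiv.addRight (1 : ℤ))).toLinearMap

variable {V}

@[simp]
theorem torusScale_apply (t : K) (f : ℤ →₀ V) (m : ℤ) : torusScale V t f m = t ^ m • f m := rfl

@[simp]
theorem torusShift_apply (f : ℤ →₀ V) (m : ℤ) :
    torusShift (K := K) V f m = f (m - 1) := by
  simp [torusShift, sub_eq_add_neg]

theorem torusScale_commute (t : K) (x : Module.End K V) :
    Commute (torusScale V t) (finsuppEnd V x) := by
  refine LinearMap.ext fun f => Finsupp.ext fun m => ?_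
  simp

theorem torusShift_commute (x : Module.End K V) :
    Commute (torusShift V) (finsuppEnd V x) := by
  refine LinearMap.ext fun f => Finsupp.ext fun m => ?_
  simp

theorem torusScale_mul_shift {t : K} (ht : t ≠ 0) :
    torusScale V t * torusShift V = t • (torusShift V * torusScale V t) := by
  refine LinearMap.ext fun f => Finsupp.ext fun m => ?_
  simp [smul_smul, zpow_sub_one₀ ht, mul_comm t, ht]

theorem torusShift_mul_scale_inv {t : K} (ht : t ≠ 0) :
    torusShift V * torusScale V t⁻¹ = t • (torusScale V t⁻¹ * torusShift V) := by
  refine LinearMap.ext fun f => Finsupp.ext fun m => ?_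
  simp only [Module.End.mul_apply, torusShift_apply, torusScale_apply, LinearMap.smul_apply,
    Finsupp.smul_apply, smul_smul, zpow_sub_one₀ (inv_ne_zero ht), inv_inv, mul_comm t]

theorem torusScale_mul_inv {t : K} (ht : t ≠ 0) :
    torusScale V t * torusScale V t⁻¹ = 1 := by
  refine LinearMap.ext fun f => Finsupp.ext fun m => ?_
  simp [smul_smul, zpow_ne_zero m ht]

theorem torusScale_inv_mul {t : K} (ht : t ≠ 0) :
    torusScale V t⁻¹ * torusScale V t = 1 := by
  refine LinearMap.ext fun f => Finsupp.ext fun m => ?_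
  simp [smul_smul, zpow_ne_zero m ht]

theorem injective_finsuppEnd {x : Module.End K V} (hx : Function.Injective x) :
    Function.Injective (finsuppEnd V x) :=
  Finsupp.mapRange_injective x (map_zero x) hx

/-- A leading term argument: the first summand preserves the index and the second raises it by one,
so they cannot cancel at the lowest index, nor just above the highest one. -/
theorem injective_scale_add_shift {t : K} (ht : t ≠ 0) {x y : Module.End K V}
    (h : Function.Injective x ∨ Function.Injective y) :
    Function.Injective fun f : ℤ →₀ V =>
      torusScale V t (finsuppEnd V x f) + torusShift (K := K) V (finsuppEnd V y f) := by
  let T : Module.End K (ℤ →₀ V) := torusScale V t * finsuppEnd V x + torusShift V * finsuppEnd V y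
  change Function.Injective T
  rw [injective_iff_map_eq_zero]
  intro f hf
  have hT : ∀ m, t ^ m • x (f m) + y (f (m - 1)) = 0 := fun m => by
    have := DFunLike.congr_fun hf m
    simpa [T] using this
  by_contra hf0
  have hne : f.support.Nonempty := Finsupp.support_nonempty_iff.2 hf0
  rcases h with hx | hy
  -- At the lowest index of the support only the unshifted summand contributes.
  · have hm := Finset.min'_mem _ hne
    have h0 : f (f.support.min' hne - 1) = 0 := by
      by_contra h1
      have := f.support.min'_le _ (Finsupp.mem_support_iff.2 h1)
      omega
    have h1 := hT (f.support.min' hne)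
    rw [h0, map_zero, add_zero, smul_eq_zero_iff_right (zpow_ne_zero _ ht)] at h1
    exact Finsupp.mem_support_iff.1 hm ((injective_iff_map_eq_zero x).1 hx _ h1)
  -- One above the highest index only the shifted summand contributes.
  · have hm := Finset.max'_mem _ hne
    have h0 : f (f.support.max' hne + 1) = 0 := by
      by_contra h1
      have := f.support.le_max' _ (Finsupp.mem_support_iff.2 h1)
      omega
    have h1 := hT (f.support.max' hne + 1)
    rw [h0, map_zero, smul_zero, zero_add, add_sub_cancel_right] at h1
    exact Finsupp.mem_support_iff.1 hm ((injective_iff_map_eq_zero y).1 hy _ h1)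

end QuantumTorus

/-! ### A representation in which all maximal minors are injective -/

section Model

variable {K : Type u} [Field K] {q : K} {k n : ℕ}

/-- There is a nonzero space with a quantum matrix of operators, for which the leftmost quantum
minor is invertible and the quantum minors with column sets in `F` are injective. -/
def HasModel (q : K) (h : k ≤ n) (F : Set (Finset (Fin n))) : Prop :=
  ∃ (V : Type u) (_ : AddCommGroup V) (_ : Module K V) (X : Fin k → Fin n → Module.End K V),
    Nontrivial V ∧ IsQuantumMatrix q X ∧ IsUnit (columnMinor q X (uSet k n) (card_uSet h)) ∧
      ∀ J (hJ : J.card = k), J ∈ F → Function.Injective ⇑(columnMinor q X J hJ)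

theorem orderEmbOfFin_uSet (h : k ≤ n) (i : Fin k) :
    (uSet k n).orderEmbOfFin (card_uSet h) i = Fin.castLE h i := by
  have h1 := Finset.orderEmbOfFin_unique (s := uSet k n) (card_uSet h)
    (f := Fin.castLE h) (fun i => by simp [uSet]) (Fin.strictMono_castLE h)
  exact (congrFun h1 i).symm

/-- The identity matrix padded by zero columns, acting on K by scalars: products of distinct entries
in one row or column vanish, and so does the right side of the diagonal relation. Its leftmost minor
is 1. -/
theorem hasModel_empty (q : K) (h : k ≤ n) : HasModel q h ∅ := by
  refine ⟨K, inferInstance, inferInstance, fun i j => if j.val = i.val then 1 else 0, inferInstance,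
    ⟨?_, ?_, ?_, ?_⟩, ?_, by simp⟩
  · intro i j l hjl
    have : j.val ≠ l.val := fun h => hjl.ne (Fin.ext h)
    by_cases h1 : j.val = i.val
    · have h2 : l.val ≠ i.val := by omega
      simp [h2]
    · simp [h1]
  · intro i l j hil
    have : i.val ≠ l.val := fun h => hil.ne (Fin.ext h)
    by_cases h1 : j.val = i.val
    · have h2 : j.val ≠ l.val := by omega
      simp [h2]
    · simp [h1]
  · intro i l j m _ _
    split_ifs <;> simp
  · intro i l j m hil hjm
    rw [Fin.lt_def] at hil hjm
    have : ¬ (m.val = i.val ∧ j.val = l.val) := by omega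
    by_cases h1 : m.val = i.val
    · have h2 : j.val ≠ l.val := by omega
      simp only [h2, if_false, mul_zero, smul_zero]
      split_ifs <;> simp
    · simp only [h1, if_false, zero_mul, smul_zero]
      split_ifs <;> simp
  · convert isUnit_one
    rw [columnMinor, quantumDet, Finset.sum_eq_single 1]
    · have h1 : permLength (1 : Equiv.Perm (Fin k)) = 0 := by
        rw [permLength, Finset.card_eq_zero, Finset.filter_eq_empty_iff]
        rintro p - ⟨h1, h2⟩
        exact lt_asymm h1 h2
      simp [h1, orderEmbOfFin_uSet h]
    · intro σ _ hσ
      obtain ⟨i, hi⟩ : ∃ i, σ i ≠ i := by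
        by_contra hcon
        push Not at hcon
        exact hσ (Equiv.ext hcon)
      rw [List.prod_eq_zero, smul_zero]
      refine List.mem_ofFn.2 ⟨i, ?_⟩
      have : (σ i).val ≠ i.val := fun h => hi (Fin.ext h)
      simp [orderEmbOfFin_uSet h, this]
    · simp

/-- After the column step the minor of a set with c' but not c is d[J] + b[J with c' replaced by c],
injective as soon as one of the two minors is. Thus J₀ is gained from its exchanged set, and nothing
already in F is lost; the other minors only acquire an invertible factor or none. -/
theorem HasModel.step (hq : q ≠ 0) {h : k ≤ n} {F : Set (Finset (Fin n))} (hF : HasModel q h F)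
    {c c' : Fin n} (hc : c'.val = c.val + 1) {J₀ : Finset (Fin n)} (h1 : c ∉ J₀) (h2 : c' ∈ J₀)
    (h3 : insert c (J₀.erase c') ∈ F) : HasModel q h (insert J₀ F) := by
  obtain ⟨V, _, _, X, hV, hX, hu, hinj⟩ := hF
  let x : Fin k → Fin n → Module.End K (ℤ →₀ V) := fun i j => finsuppEnd V (X i j)
  have hx : IsQuantumMatrix q x := hX.map (finsuppEnd V)
  let Y := columnStep x (torusScale V q) (torusShift V) (torusScale V q⁻¹) c c'
  have hY : IsQuantumMatrix q Y := hx.columnStep hq hc (fun i j => torusScale_commute q (X i j))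
    (fun i j => torusShift_commute (X i j)) (fun i j => torusScale_commute q⁻¹ (X i j))
    (torusScale_mul_shift hq) (torusShift_mul_scale_inv hq)
    ((torusScale_mul_inv hq).trans (torusScale_inv_mul hq).symm)
  have hminor := fun J (hJ : J.card = k) f => columnMinor_columnStep (X := x) hc
    (fun i j => torusScale_commute q (X i j)) (fun i j => torusShift_commute (X i j))
    (fun i j => torusScale_commute q⁻¹ (X i j)) (torusScale_mul_shift hq) (torusScale_mul_inv hq)
    (torusScale_inv_mul hq) J hJ f
  simp only [exteriorStep_apply] at hminor
  have hlift : ∀ J (hJ : J.card = k), columnMinor q x J hJ = finsuppEnd V (columnMinor q X J hJ) :=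
    fun J hJ => (map_columnMinor X J hJ (finsuppEnd V)).symm
  have hscale : Function.Injective (torusScale V q) :=
    Function.LeftInverse.injective (g := torusScale V q⁻¹)
      fun f => LinearMap.congr_fun (torusScale_inv_mul hq) f
  have hswap : ∀ J : Finset (Fin n), J.card = k → c ∉ J → c' ∈ J →
      (insert c (J.erase c')).card = k := by
    intro J hJ h4 h5
    rw [Finset.card_insert_of_notMem (by simp [h4]), Finset.card_erase_add_one h5, hJ]
  have hmix : ∀ J (hJ : J.card = k) (h4 : c ∉ J) (h5 : c' ∈ J),
      (Function.Injective ⇑(columnMinor q X J hJ)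
        ∨ Function.Injective ⇑(columnMinor q X (insert c (J.erase c')) (hswap J hJ h4 h5))) →
      Function.Injective ⇑(columnMinor q Y J hJ) := by
    intro J hJ h4 h5 h6
    convert injective_scale_add_shift (inv_ne_zero hq) h6 using 1
    funext f
    rw [hminor J hJ f, if_neg h4, if_pos h5, dif_pos hJ, dif_pos (hswap J hJ h4 h5), hlift, hlift]
  refine ⟨ℤ →₀ V, inferInstance, inferInstance, Y, inferInstance, hY, ?_, ?_⟩
  · by_cases h4 : c ∈ uSet k n
    · by_cases h5 : c' ∈ uSet k n
      · convert hu.map (finsuppEnd V)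
        refine LinearMap.ext fun f => ?_
        rw [hminor _ _ f, if_pos h4, if_pos h5, dif_pos (card_uSet h), hlift]
      · have hunit : IsUnit (torusScale V q) :=
          ⟨⟨_, _, torusScale_mul_inv hq, torusScale_inv_mul hq⟩, rfl⟩
        convert hunit.mul (hu.map (finsuppEnd V))
        refine LinearMap.ext fun f => ?_
        rw [hminor _ _ f, if_pos h4, if_neg h5, dif_pos (card_uSet h), hlift]
        rfl
    -- An initial segment that misses c also misses its successor, so [u] never becomes a sum.
    · have h5 : c' ∉ uSet k n := by
        simp only [uSet, Finset.mem_filter, Finset.mem_univ, true_and] at h4 ⊢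
        omega
      convert hu.map (finsuppEnd V)
      refine LinearMap.ext fun f => ?_
      rw [hminor _ _ f, if_neg h4, if_neg h5, dif_pos (card_uSet h), hlift]
  · rintro J hJ (rfl | hJF)
    · exact hmix J hJ h1 h2 (Or.inr (hinj _ _ h3))
    · by_cases h4 : c ∈ J
      · by_cases h5 : c' ∈ J
        · convert injective_finsuppEnd (hinj J hJ hJF) using 1
          funext f
          rw [hminor _ _ f, if_pos h4, if_pos h5, dif_pos hJ, hlift]
        · convert hscale.comp (injective_finsuppEnd (hinj J hJ hJF)) using 1
          funext f
          rw [hminor _ _ f, if_pos h4, if_neg h5, dif_pos hJ, hlift]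
          rfl
      · by_cases h5 : c' ∈ J
        · exact hmix J hJ h4 h5 (Or.inl (hinj J hJ hJF))
        · convert injective_finsuppEnd (hinj J hJ hJF) using 1
          funext f
          rw [hminor _ _ f, if_neg h4, if_neg h5, dif_pos hJ, hlift]

theorem HasModel.mono {h : k ≤ n} {F G : Set (Finset (Fin n))} (hF : HasModel q h F)
    (hG : G ⊆ F) : HasModel q h G := by
  obtain ⟨V, i₁, i₂, X, hV, hX, hu, hinj⟩ := hF
  exact ⟨V, i₁, i₂, X, hV, hX, hu, fun J hJ hJG => hinj J hJ (hG hJG)⟩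

/-- A set that is not an initial segment contains an element whose predecessor it misses. -/
theorem exists_gap {h : k ≤ n} {J : Finset (Fin n)} (hJ : J.card = k) (hne : J ≠ uSet k n) :
    ∃ c c' : Fin n, c'.val = c.val + 1 ∧ c ∉ J ∧ c' ∈ J := by
  by_contra hcon
  push Not at hcon
  have hdown : ∀ d : ℕ, ∀ c c' : Fin n, c'.val = c.val + d → c' ∈ J → c ∈ J := by
    intro d
    induction d with
    | zero => intro c c' h1 h2; rwa [Fin.ext (h1 : c'.val = c.val)] at h2
    | succ d ih =>
      intro c c' h1 h2
      have hlt : c.val + 1 < n := by have := c'.isLt; omega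
      by_contra h3
      exact hcon c ⟨c.val + 1, hlt⟩ rfl h3 (ih _ c' (by simp; omega) h2)
  apply hne
  symm
  apply Finset.eq_of_subset_of_card_le
  · intro a ha
    by_contra haJ
    simp only [uSet, Finset.mem_filter, Finset.mem_univ, true_and] at ha
    have hsub : J ⊆ (uSet k n).erase a := by
      intro b hb
      have hab : b.val < a.val := by
        by_contra hba
        exact haJ (hdown (b.val - a.val) a b (by omega) hb)
      simp only [uSet, Finset.mem_erase, Finset.mem_filter, Finset.mem_univ, true_and, ne_eq,
        Fin.ext_iff]
      omega
    have h1 := Finset.card_le_card hsub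
    have h2 : a ∈ uSet k n := by simp [uSet, ha]
    have h3 := Finset.card_erase_add_one h2
    rw [card_uSet h] at h3
    omega
  · rw [hJ, card_uSet h]

/-- Induction on the sum of the elements of J: replacing c' by its missing predecessor lowers the
sum by one, and the process ends at the initial segment, where the minor is invertible. -/
theorem HasModel.insert (hq : q ≠ 0) {h : k ≤ n} {F : Set (Finset (Fin n))}
    (hF : HasModel q h F) (J : Finset (Fin n)) (hJ : J.card = k) :
    HasModel q h (insert J F) := by
  induction hN : ∑ j ∈ J, j.val using Nat.strong_induction_on generalizing J with
  | _ N ih =>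
    by_cases hne : J = uSet k n
    · subst hne
      obtain ⟨V, i₁, i₂, X, hV, hX, hu, hinj⟩ := hF
      refine ⟨V, i₁, i₂, X, hV, hX, hu, ?_⟩
      rintro I hI (rfl | hIF)
      · exact ((Module.End.isUnit_iff _).1 hu).injective
      · exact hinj I hI hIF
    · obtain ⟨c, c', hc, h1, h2⟩ := exists_gap (h := h) hJ hne
      have h3 : c ∉ J.erase c' := by simp [h1]
      have hcard : (Insert.insert c (J.erase c')).card = k := by
        rw [Finset.card_insert_of_notMem h3, Finset.card_erase_add_one h2, hJ]
      have hsum : ∑ j ∈ Insert.insert c (J.erase c'), j.val < N := by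
        rw [Finset.sum_insert h3, ← hN, ← Finset.add_sum_erase J _ h2]
        omega
      have := ih _ hsum _ hcard rfl
      -- The auxiliary exchanged set is dropped again.
      exact (this.step hq hc h1 h2 (Set.mem_insert _ _)).mono
        (Set.insert_subset_insert (Set.subset_insert _ _))

theorem hasModel_univ (hq : q ≠ 0) (h : k ≤ n) : HasModel q h Set.univ := by
  have key : ∀ T : Finset (Finset (Fin n)), HasModel q h (T : Set (Finset (Fin n))) := by
    intro T
    induction T using Finset.induction_on with
    | empty => simpa using hasModel_empty q h
    | insert J T _ ih =>
      rw [Finset.coe_insert]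
      by_cases hJ : J.card = k
      · exact ih.insert hq J hJ
      · obtain ⟨V, i₁, i₂, X, hV, hX, hu, hinj⟩ := ih
        refine ⟨V, i₁, i₂, X, hV, hX, hu, ?_⟩
        rintro I hI (rfl | hIF)
        · exact absurd hI hJ
        · exact hinj I hI hIF
  simpa using key Finset.univ

end Model

/-! ### Derivations of a localisation -/

section InvertAt

variable {K : Type*} [Field K] {A : Type*} [Ring A] [Algebra K A]

theorem InvertAt.subalgebra_eq_top (s : A) (U : Subalgebra K (InvertAt K s))
    (hof : ∀ a, InvertAt.of K s a ∈ U) (hinv : InvertAt.inv K s ∈ U) : U = ⊤ := by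
  rw [eq_top_iff]
  rintro t -
  obtain ⟨f, rfl⟩ := RingQuot.mkAlgHom_surjective K (InvRel K s) t
  have h : (⊤ : Subalgebra K (FreeAlgebra K (Option A)))
      ≤ U.comap (RingQuot.mkAlgHom K (InvRel K s)) := by
    rw [← FreeAlgebra.adjoin_range_ι, Algebra.adjoin_le_iff]
    rintro _ ⟨o, rfl⟩
    cases o with
    | some a => exact hof a
    | none => exact hinv
  exact h trivial

theorem IsDeriv.map_one {D : A →ₗ[K] A} (hD : IsDeriv D) : D 1 = 0 := by
  have h := hD 1 1
  simpa using h

theorem IsDeriv.map_algebraMap {D : A →ₗ[K] A} (hD : IsDeriv D) (r : K) :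
    D (algebraMap K A r) = 0 := by
  rw [Algebra.algebraMap_eq_smul_one, map_smul, hD.map_one, smul_zero]

/-- A derivation is determined on the localisation by its values on the original algebra. -/
theorem InvertAt.derivation_ext {s : A} {D₁ D₂ : InvertAt K s →ₗ[K] InvertAt K s}
    (h₁ : IsDeriv D₁) (h₂ : IsDeriv D₂)
    (h : ∀ a, D₁ (InvertAt.of K s a) = D₂ (InvertAt.of K s a)) : D₁ = D₂ := by
  let U : Subalgebra K (InvertAt K s) :=
    { carrier := {t | D₁ t = D₂ t}
      mul_mem' := fun {a b} ha hb => by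
        simp only [Set.mem_ofPred_eq] at ha hb ⊢
        rw [h₁, h₂, ha, hb]
      add_mem' := fun {a b} ha hb => by
        simp only [Set.mem_ofPred_eq] at ha hb ⊢
        rw [map_add, map_add, ha, hb]
      algebraMap_mem' := fun r => by
        simp only [Set.mem_ofPred_eq]
        rw [h₁.map_algebraMap, h₂.map_algebraMap] }
  have hU : U = ⊤ := by
    apply InvertAt.subalgebra_eq_top s U h
    -- Differentiating s s⁻¹ = 1 forces D(s⁻¹) = -s⁻¹ D(s) s⁻¹.
    have key : ∀ D : InvertAt K s →ₗ[K] InvertAt K s, IsDeriv D →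
        D (InvertAt.inv K s)
          = -(InvertAt.inv K s * D (InvertAt.of K s s) * InvertAt.inv K s) := by
      intro D hD
      have h1 := hD (InvertAt.of K s s) (InvertAt.inv K s)
      rw [InvertAt.of_mul_inv, hD.map_one] at h1
      have h2 := congrArg (InvertAt.inv K s * ·) h1
      simp only [mul_zero, mul_add, ← mul_assoc, InvertAt.inv_mul_of, one_mul] at h2
      exact (neg_eq_of_add_eq_zero_right h2.symm).symm
    change D₁ _ = D₂ _
    rw [key D₁ h₁, key D₂ h₂, h]
  ext t
  have : t ∈ U := hU ▸ trivial
  exact this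

/-- Derivations extend to localisations. -/
theorem InvertAt.exists_derivation (s : A) (D : A →ₗ[K] A) (hD : IsDeriv D) :
    ∃ D' : InvertAt K s →ₗ[K] InvertAt K s, IsDeriv D' ∧
      ∀ a, D' (InvertAt.of K s a) = InvertAt.of K s (D a) := by
  -- A derivation is the same as an algebra map a ↦ a + ε D(a) into the dual numbers; its value at s
  -- is invertible because its constant term is.
  let F : A →ₐ[K] TrivSqZeroExt (InvertAt K s) (InvertAt K s) :=
    AlgHom.ofLinearMap
      { toFun := fun a => TrivSqZeroExt.inl (InvertAt.of K s a)
          + TrivSqZeroExt.inr (InvertAt.of K s (D a))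
        map_add' := fun a b => by refine TrivSqZeroExt.ext ?_ ?_ <;> simp
        map_smul' := fun r a => by refine TrivSqZeroExt.ext ?_ ?_ <;> simp }
      (by refine TrivSqZeroExt.ext ?_ ?_ <;> simp [hD.map_one])
      (fun a b => by refine TrivSqZeroExt.ext ?_ ?_ <;> simp [hD a b, add_comm])
  have hFfst : ∀ a, (F a).fst = InvertAt.of K s a := fun a => by simp [F]
  have hFsnd : ∀ a, (F a).snd = InvertAt.of K s (D a) := fun a => by simp [F]
  have hunit : IsUnit (F s) := by
    rw [TrivSqZeroExt.isUnit_iff_isUnit_fst, hFfst]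
    exact ⟨⟨_, _, InvertAt.of_mul_inv K s, InvertAt.inv_mul_of K s⟩, rfl⟩
  obtain ⟨G, hG, -⟩ := InvertAt.lift_spec K s F hunit
  have hGof : ∀ a, G (InvertAt.of K s a) = F a := fun a => by rw [← hG]; rfl
  -- By uniqueness of lifts the constant term is the identity, so multiplicativity of `G` is the
  -- Leibniz rule for the ε-part.
  have hfst : ∀ t, (G t).fst = t := by
    have h1 : (TrivSqZeroExt.fstHom K (InvertAt K s) (InvertAt K s)).comp G
        = AlgHom.id K (InvertAt K s) := by
      refine (InvertAt.lift_spec K s (InvertAt.of K s)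
        ⟨⟨_, _, InvertAt.of_mul_inv K s, InvertAt.inv_mul_of K s⟩, rfl⟩).unique ?_ ?_
      · ext a
        simp [hGof, hFfst]
      · ext a
        simp
    exact fun t => AlgHom.congr_fun h1 t
  refine ⟨(TrivSqZeroExt.sndHom (InvertAt K s) (InvertAt K s)).restrictScalars K ∘ₗ G.toLinearMap,
    ?_, ?_⟩
  · intro a b
    simp [hfst, add_comm]
  · intro a
    simp [hGof, hFsnd]

end InvertAt

/-! ### The column grading -/

section Weights

variable {n : ℕ}

/-- The multidegree of a quantum minor. -/
def columnWeight (J : Finset (Fin n)) : Fin n → ℤ := ∑ j ∈ J, Pi.single j 1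

theorem columnWeight_apply (J : Finset (Fin n)) (a : Fin n) :
    columnWeight J a = if a ∈ J then 1 else 0 := by
  simp [columnWeight, Finset.sum_apply, Pi.single_apply]

variable {K : Type*} [Field K] {q : K} {A : Type*} [Ring A] [Algebra K A] {k : ℕ}

/-- The quantum matrix with independent variables adjoined to its columns. -/
noncomputable def gradedMatrix (x : Fin k → Fin n → A) (i : Fin k) (j : Fin n) :
    AddMonoidAlgebra A (Fin n → ℤ) :=
  AddMonoidAlgebra.single (Pi.single j 1) (x i j)

/-- The relations are homogeneous: both sides use the same multiset of columns. -/
theorem IsQuantumMatrix.graded {x : Fin k → Fin n → A} (hx : IsQuantumMatrix q x) :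
    IsQuantumMatrix q (gradedMatrix x) where
  row i j l h := by
    simp only [gradedMatrix, AddMonoidAlgebra.single_mul_single, AddMonoidAlgebra.smul_single,
      hx.row i j l h, add_comm]
  col i l j h := by
    simp only [gradedMatrix, AddMonoidAlgebra.single_mul_single, AddMonoidAlgebra.smul_single,
      hx.col i l j h]
  anti i m j l h h' := by
    simp only [gradedMatrix, AddMonoidAlgebra.single_mul_single, hx.anti i m j l h h', add_comm]
  diag i m j l h h' := by
    simp only [gradedMatrix, AddMonoidAlgebra.single_mul_single, AddMonoidAlgebra.smul_single,
      ← hx.diag i m j l h h']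
    rw [add_comm (Pi.single l 1), AddMonoidAlgebra.single_sub]

theorem prod_ofFn_single {G : Type*} [AddCommMonoid G] : ∀ {t : ℕ} (g : Fin t → G) (y : Fin t → A),
    (List.ofFn fun i => AddMonoidAlgebra.single (g i) (y i)).prod
      = AddMonoidAlgebra.single (∑ i, g i) (List.ofFn y).prod
  | 0, _, _ => by simp [AddMonoidAlgebra.one_def]
  | t + 1, g, y => by
    rw [List.ofFn_succ, List.prod_cons, prod_ofFn_single, AddMonoidAlgebra.single_mul_single,
      List.ofFn_succ, List.prod_cons, Fin.sum_univ_succ]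

theorem columnMinor_gradedMatrix (x : Fin k → Fin n → A) (J : Finset (Fin n)) (hJ : J.card = k) :
    columnMinor q (gradedMatrix x) J hJ
      = AddMonoidAlgebra.single (columnWeight J) (columnMinor q x J hJ) := by
  have h1 : ∀ σ : Equiv.Perm (Fin k),
      (List.ofFn fun i => gradedMatrix x i (J.orderEmbOfFin hJ (σ i))).prod
        = AddMonoidAlgebra.single (columnWeight J)
          (List.ofFn fun i => x i (J.orderEmbOfFin hJ (σ i))).prod := by
    intro σ
    simp only [gradedMatrix]
    rw [prod_ofFn_single]
    congr 1
    rw [Equiv.sum_comp σ (fun i => (Pi.single (J.orderEmbOfFin hJ i) 1 : Fin n → ℤ)), columnWeight]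
    conv_rhs => rw [← Finset.image_orderEmbOfFin_univ J hJ]
    rw [Finset.sum_image fun a _ b _ h => (J.orderEmbOfFin hJ).injective h]
  simp only [columnMinor, quantumDet, h1, AddMonoidAlgebra.smul_single]
  exact (map_sum (AddMonoidAlgebra.singleAddHom (columnWeight J)) _ _).symm

end Weights

/-! ### Linear independence in the localisation -/

section Independence

variable {K : Type u} [Field K] {q : K} {k n : ℕ}

/-- The products of the numerator of a generator of `R` with a power of `[u]`. -/
noncomputable def pluckerMulPow (q : K) (h : k ≤ n) (p : (Fin k × Fin (n - k)) × ℕ) :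
    QGrass q k n :=
  plucker q (xSet p.1.1 p.1.2) (card_xSet p.1.1 p.1.2) * QGrass.u q h ^ p.2

theorem mem_xSet {i : Fin k} {j : Fin (n - k)} {a : Fin n} :
    a ∈ xSet i j ↔ a.val = j.val + k ∨ (a.val ≠ k - 1 - i.val ∧ a.val < k) := by
  simp [xSet, uSet, Fin.ext_iff]

/-- The only column of positive degree beyond the k-th, apart from the fixed contribution of [w],
reveals j. Among the first k columns the degree is d + 1 except at the omitted one, where it is d;
this reveals i and d. -/
theorem injective_weight (h : k ≤ n) :
    Function.Injective fun p : (Fin k × Fin (n - k)) × ℕ =>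
      columnWeight (wSet k n) + (columnWeight (xSet p.1.1 p.1.2) + p.2 • columnWeight (uSet k n)) := by
  rintro ⟨⟨i, j⟩, d⟩ ⟨⟨i', j'⟩, d'⟩ hp
  have hp' : ∀ a, (if a ∈ xSet i j then (1 : ℤ) else 0) + d * (if a.val < k then 1 else 0)
      = (if a ∈ xSet i' j' then 1 else 0) + d' * (if a.val < k then 1 else 0) := by
    intro a
    have h1 := congrFun (add_left_cancel hp) a
    simpa [columnWeight_apply, uSet] using h1
  have hi := i.isLt
  have hi' := i'.isLt
  have hj := j.isLt
  have hjj : j = j' := by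
    have h1 := hp' ⟨j.val + k, by omega⟩
    by_contra hne
    have h2 : j.val ≠ j'.val := fun h => hne (Fin.ext h)
    simp [mem_xSet, h2] at h1
  have h1 := hp' ⟨k - 1 - i.val, by omega⟩
  have h2 := hp' ⟨k - 1 - i'.val, by omega⟩
  have e1 : k - 1 - i.val < k := by omega
  have e2 : k - 1 - i'.val < k := by omega
  have e3 : ∀ m : ℕ, k - 1 - i.val ≠ m + k := by omega
  have e4 : ∀ m : ℕ, k - 1 - i'.val ≠ m + k := by omega
  simp only [mem_xSet, e1, e2, e3, e4, false_or, ne_eq, not_true, if_true, if_false,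
    and_true, mul_one, zero_add] at h1 h2
  -- Evaluating at the two omitted columns would give d = d' + 1 and d' = d + 1.
  have hii : i = i' := by
    by_contra hne
    have h3 : i.val ≠ i'.val := fun h => hne (Fin.ext h)
    have h4 : ¬ k - 1 - i.val = k - 1 - i'.val := by omega
    have h5 : ¬ k - 1 - i'.val = k - 1 - i.val := by omega
    rw [if_pos h4] at h1
    rw [if_pos h5] at h2
    omega
  subst hii
  simp only [not_true, if_false, zero_add] at h1
  have : d = d' := by exact_mod_cast h1
  rw [hjj, this]

/-- The model, tensored with the column grading, extends to T because [u] acts invertibly. The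
images are homogeneous of distinct degrees, and nonzero since a composite of injective operators on
a nonzero space is nonzero. -/
theorem linearIndependent_w_mul (hq : q ≠ 0) (h : k ≤ n) :
    LinearIndependent K fun p => QGrassLoc.of q h (QGrass.w q h * pluckerMulPow q h p) := by
  obtain ⟨V, _, _, X, hV, hX, hu, hinj⟩ := hasModel_univ (q := q) hq h
  obtain ⟨f, hf⟩ := hX.graded.exists_algHom
  have hminor : ∀ J (hJ : J.card = k), f.comp (QGrass q k n).val (plucker q J hJ)
      = AddMonoidAlgebra.single (columnWeight J) (columnMinor q X J hJ) := by
    intro J hJ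
    rw [← columnMinor_gradedMatrix]
    change f (columnMinor q _ J hJ) = _
    rw [map_columnMinor]
    simp only [hf]
  have hunit : IsUnit (f.comp (QGrass q k n).val (QGrass.u q h)) := by
    obtain ⟨y, hy⟩ := hu
    have h1 : f.comp (QGrass q k n).val (QGrass.u q h)
        = AddMonoidAlgebra.single (columnWeight (uSet k n)) (y : Module.End K V) := by
      rw [hy]; exact hminor _ _
    rw [h1]
    refine ⟨⟨AddMonoidAlgebra.single (columnWeight (uSet k n)) (y : Module.End K V),
      AddMonoidAlgebra.single (-columnWeight (uSet k n)) (↑y⁻¹ : Module.End K V), ?_, ?_⟩, rfl⟩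
    · rw [AddMonoidAlgebra.single_mul_single, Units.mul_inv, add_neg_cancel,
        AddMonoidAlgebra.one_def]
    · rw [AddMonoidAlgebra.single_mul_single, Units.inv_mul, neg_add_cancel,
        AddMonoidAlgebra.one_def]
  obtain ⟨G, hG, -⟩ := InvertAt.lift_spec K (QGrass.u q h) _ hunit
  apply LinearIndependent.of_comp G.toLinearMap
  let y : (Fin k × Fin (n - k)) × ℕ → Module.End K V := fun p =>
    columnMinor q X (wSet k n) (card_wSet h) *
      (columnMinor q X (xSet p.1.1 p.1.2) (card_xSet p.1.1 p.1.2)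
        * columnMinor q X (uSet k n) (card_uSet h) ^ p.2)
  have hy : ∀ p, y p ≠ 0 := by
    intro p hp
    have h1 : Function.Injective ⇑(y p) := by
      have h2 : Function.Injective ⇑(columnMinor q X (uSet k n) (card_uSet h) ^ p.2) := by
        rw [Module.End.coe_pow]
        exact (hinj _ _ trivial).iterate _
      exact (hinj _ (card_wSet h) trivial).comp ((hinj _ (card_xSet _ _) trivial).comp h2)
    rw [hp] at h1
    obtain ⟨v, hv⟩ := exists_ne (0 : V)
    exact hv (h1 rfl)
  have hGy : G.toLinearMap ∘ (fun p => QGrassLoc.of q h (QGrass.w q h * pluckerMulPow q h p))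
      = fun p => AddMonoidAlgebra.single (columnWeight (wSet k n)
        + (columnWeight (xSet p.1.1 p.1.2) + p.2 • columnWeight (uSet k n))) (y p) := by
    funext p
    have h1 : ∀ a, G (QGrassLoc.of q h a) = f.comp (QGrass q k n).val a := fun a =>
      AlgHom.congr_fun hG a
    change G (QGrassLoc.of q h _) = _
    rw [h1, pluckerMulPow, map_mul, map_mul, map_pow, QGrass.w, QGrass.u, hminor, hminor, hminor,
      AddMonoidAlgebra.single_pow, AddMonoidAlgebra.single_mul_single,
      AddMonoidAlgebra.single_mul_single]
  rw [hGy, linearIndependent_iff']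
  intro s c hc p hp
  have h1 := congrArg (fun z : AddMonoidAlgebra (Module.End K V) (Fin n → ℤ) =>
    z.coeff (columnWeight (wSet k n)
        + (columnWeight (xSet p.1.1 p.1.2) + p.2 • columnWeight (uSet k n)))) hc
  simp only [AddMonoidAlgebra.smul_single, AddMonoidAlgebra.coeff_sum, Finsupp.coe_finsetSum,
    Finset.sum_apply, AddMonoidAlgebra.coeff_single, AddMonoidAlgebra.coeff_zero,
    Finsupp.coe_zero, Pi.zero_apply] at h1
  rw [Finset.sum_eq_single p] at h1
  · rw [Finsupp.single_eq_same] at h1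
    exact (smul_eq_zero.1 h1).resolve_right (hy p)
  · intro p' _ hne
    rw [Finsupp.single_apply, if_neg]
    exact fun h2 => hne (injective_weight h h2)
  · exact fun h2 => absurd hp h2

end Independence

/-! ### Elements with prescribed commutation with the extreme coordinates -/

section Decomposition

variable {K : Type u} [Field K] {q : K} {k n : ℕ}

theorem eq_uSet_of_filter (h : k ≤ n) {J : Finset (Fin n)} (hJ : J.card = k)
    (h0 : (J.filter fun c => k ≤ c.val).card = 0) : J = uSet k n := by
  apply Finset.eq_of_subset_of_card_le
  · intro a ha
    rw [Finset.card_eq_zero, Finset.filter_eq_empty_iff] at h0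
    have := h0 ha
    simp only [uSet, Finset.mem_filter, Finset.mem_univ, true_and]
    omega
  · rw [hJ, card_uSet h]

theorem eq_xSet_of_filter (h : k ≤ n) {J : Finset (Fin n)} (hJ : J.card = k)
    (h1 : (J.filter fun c => k ≤ c.val).card = 1) :
    ∃ (i : Fin k) (j : Fin (n - k)), J = xSet i j := by
  obtain ⟨b, hb⟩ := Finset.card_eq_one.1 h1
  have hmem : ∀ a, (a ∈ J ∧ k ≤ a.val) ↔ a = b := fun a => by
    rw [← Finset.mem_singleton, ← hb, Finset.mem_filter]
  obtain ⟨hbJ, hbk⟩ := (hmem b).2 rfl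
  obtain ⟨a, hau, haJ⟩ : ∃ a ∈ uSet k n, a ∉ J := by
    by_contra hcon
    push Not at hcon
    have h2 : uSet k n ⊆ J.erase b := by
      intro a ha
      rw [Finset.mem_erase]
      refine ⟨?_, hcon a ha⟩
      rintro rfl
      simp only [uSet, Finset.mem_filter, Finset.mem_univ, true_and] at ha
      omega
    have h3 := Finset.card_le_card h2
    have h4 := Finset.card_erase_add_one hbJ
    rw [card_uSet h] at h3
    omega
  simp only [uSet, Finset.mem_filter, Finset.mem_univ, true_and] at hau
  have hbn := b.isLt
  refine ⟨⟨k - 1 - a.val, by omega⟩, ⟨b.val - k, by omega⟩, ?_⟩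
  apply Finset.eq_of_subset_of_card_le
  · intro c hc
    rw [mem_xSet]
    by_cases hck : k ≤ c.val
    · left
      rw [(hmem c).1 ⟨hc, hck⟩]
      simp; omega
    · right
      have : c.val ≠ a.val := fun h => haJ ((Fin.ext h : c = a) ▸ hc)
      simp only
      omega
  · rw [hJ, card_xSet]

/-- The exponent α is the total number of columns beyond the k-th. If α = 0 all factors are [u]; if
α = 1 exactly one is a numerator of a generator, and the powers of [u] to its left can be moved to
the right at the cost of a scalar. -/
theorem u_mul_list_prod (hq : q ≠ 0) (h : k ≤ n) (l : List (QGrass q k n))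
    (hl : ∀ y ∈ l, ∃ (J : Finset (Fin n)) (hJ : J.card = k), y = plucker q J hJ) :
    ∃ α : ℕ, QGrass.u q h * l.prod = q ^ α • (l.prod * QGrass.u q h) ∧
      (α = 0 → ∃ d : ℕ, l.prod = QGrass.u q h ^ d) ∧
      (α = 1 → ∃ (r : K) (p : _), l.prod = r • pluckerMulPow q h p) := by
  induction l with
  | nil => exact ⟨0, by simp, fun _ => ⟨0, by simp⟩, fun h => absurd h (by simp)⟩
  | cons y l ih =>
    obtain ⟨α, h1, h2, h3⟩ := ih fun z hz => hl z (List.mem_cons_of_mem _ hz)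
    obtain ⟨J, hJ, rfl⟩ := hl y List.mem_cons_self
    refine ⟨(J.filter fun c => k ≤ c.val).card + α, ?_, ?_, ?_⟩
    · rw [List.prod_cons, ← mul_assoc, u_mul_plucker hq h J hJ, smul_mul_assoc, mul_assoc, h1,
        mul_smul_comm, smul_smul, pow_add, mul_assoc]
    · intro h4
      obtain ⟨h5, h6⟩ := Nat.add_eq_zero_iff.1 h4
      have h7 := eq_uSet_of_filter h hJ h5
      subst h7
      obtain ⟨d, hd⟩ := h2 h6
      refine ⟨d + 1, ?_⟩
      rw [List.prod_cons, hd, pow_succ']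
      rfl
    · intro h4
      rcases Nat.add_eq_one_iff.1 h4 with ⟨h5, h6⟩ | ⟨h5, h6⟩
      · have h7 := eq_uSet_of_filter h hJ h5
        subst h7
        obtain ⟨r, ⟨⟨i, j⟩, d⟩, hd⟩ := h3 h6
        refine ⟨r * q ^ ((xSet i j).filter fun c => k ≤ c.val).card, ⟨⟨i, j⟩, d + 1⟩, ?_⟩
        rw [List.prod_cons, hd]
        change QGrass.u q h * (r • (plucker q _ _ * QGrass.u q h ^ d)) = _
        rw [mul_smul_comm, ← mul_assoc, u_mul_plucker hq h, smul_mul_assoc, smul_smul, mul_assoc,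
          ← pow_succ']
        rfl
      · obtain ⟨i, j, h7⟩ := eq_xSet_of_filter h hJ h5
        subst h7
        obtain ⟨d, hd⟩ := h2 h6
        refine ⟨1, ⟨⟨i, j⟩, d⟩, ?_⟩
        rw [List.prod_cons, hd, one_smul]
        rfl

theorem pow_injective_of_not_root (hq0 : q ≠ 0) (hq : ∀ m : ℕ, 0 < m → q ^ m ≠ 1) {a b : ℕ}
    (h : q ^ a = q ^ b) : a = b := by
  wlog hab : a ≤ b generalizing a b
  · exact (this h.symm (le_of_not_ge hab)).symm
  obtain ⟨c, rfl⟩ := Nat.exists_eq_add_of_le hab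
  by_contra hne
  have hc : 0 < c := by omega
  rw [pow_add] at h
  exact hq c hc (mul_left_cancel₀ (pow_ne_zero a hq0) (by rw [← h, mul_one]))

theorem QGrass.adjoin_plucker_eq_top :
    Algebra.adjoin K {y : QGrass q k n | ∃ (J : Finset (Fin n)) (hJ : J.card = k),
      y = plucker q J hJ} = ⊤ := by
  have h := Algebra.adjoin_adjoin_coe_preimage (R := K)
    (s := {a | ∃ (J : Finset (Fin n)) (hJ : J.card = k), a = maximalMinor q J hJ})
  refine Eq.trans (congrArg (Algebra.adjoin K) (Set.ext fun y => ?_)) h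
  constructor
  · rintro ⟨J, hJ, rfl⟩
    exact ⟨J, hJ, rfl⟩
  · rintro ⟨J, hJ, hy⟩
    exact ⟨J, hJ, Subtype.ext hy⟩

/-- The elements of the quantum grassmannian on which conjugation with `[u]` acts in the same way
as on the generators of `R`. -/
theorem of_mem_span_of_qcommute (hq0 : q ≠ 0) (hq : ∀ m : ℕ, 0 < m → q ^ m ≠ 1) (h : k ≤ n)
    (a : QGrass q k n) (ha : QGrass.u q h * a = q • (a * QGrass.u q h)) :
    QGrassLoc.of q h a
      ∈ Submodule.span K (Set.range fun p => QGrassLoc.of q h (pluckerMulPow q h p)) := by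
  -- Conjugation t ↦ [u] t [u]⁻¹, diagonal on the monomials in the Plücker coordinates.
  let φ : Module.End K (QGrassLoc q h) :=
    LinearMap.mulLeft K (QGrassLoc.of q h (QGrass.u q h))
      * LinearMap.mulRight K (QGrassLoc.uInv q h)
  have hφ : ∀ (b : QGrass q k n) (μ : K), QGrass.u q h * b = μ • (b * QGrass.u q h) →
      QGrassLoc.of q h b ∈ φ.eigenspace μ := by
    intro b μ hb
    rw [Module.End.mem_eigenspace_iff]
    change QGrassLoc.of q h (QGrass.u q h) * (QGrassLoc.of q h b * QGrassLoc.uInv q h) = _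
    rw [← mul_assoc, ← map_mul, hb, map_smul, map_mul, smul_mul_assoc, mul_assoc,
      InvertAt.of_mul_inv, mul_one]
  let N := Submodule.span K (Set.range fun p => QGrassLoc.of q h (pluckerMulPow q h p))
  have hN : N ≤ φ.eigenspace q := by
    rw [Submodule.span_le]
    rintro _ ⟨⟨⟨i, j⟩, d⟩, rfl⟩
    apply hφ
    have h1 : ((xSet i j).filter fun c => k ≤ c.val).card = 1 := by
      rw [Finset.card_eq_one]
      refine ⟨⟨j.val + k, by have := j.isLt; omega⟩, ?_⟩
      ext c
      simp only [Finset.mem_filter, mem_xSet, Finset.mem_singleton, Fin.ext_iff]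
      omega
    simp only [pluckerMulPow]
    rw [← mul_assoc, u_mul_plucker hq0 h, h1, pow_one, smul_mul_assoc, mul_assoc, mul_assoc,
      ← pow_succ, ← pow_succ']
  have hall : ∀ b : QGrass q k n,
      QGrassLoc.of q h b ∈ N ⊔ ⨆ (μ : K) (_ : μ ≠ q), φ.eigenspace μ := by
    intro b
    have hb : b ∈ Submodule.span K (Submonoid.closure {y : QGrass q k n |
        ∃ (J : Finset (Fin n)) (hJ : J.card = k), y = plucker q J hJ} : Set (QGrass q k n)) := by
      rw [← Algebra.adjoin_eq_span, QGrass.adjoin_plucker_eq_top]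
      trivial
    induction hb using Submodule.span_induction with
    | mem y hy =>
      obtain ⟨l, hl, rfl⟩ := Submonoid.exists_list_of_mem_closure hy
      obtain ⟨α, h1, -, h3⟩ := u_mul_list_prod hq0 h l hl
      by_cases hα : α = 1
      · obtain ⟨r, p, hp⟩ := h3 hα
        apply Submodule.mem_sup_left
        rw [hp, map_smul]
        exact Submodule.smul_mem _ _ (Submodule.subset_span ⟨p, rfl⟩)
      · apply Submodule.mem_sup_right
        refine Submodule.mem_iSup_of_mem (q ^ α) (Submodule.mem_iSup_of_mem ?_ (hφ _ _ h1))
        intro h4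
        exact hα (pow_injective_of_not_root hq0 hq (by rw [h4, pow_one]))
    | zero => rw [map_zero]; exact Submodule.zero_mem _
    | add x y _ _ hx hy => rw [map_add]; exact Submodule.add_mem _ hx hy
    | smul r x _ hx => rw [map_smul]; exact Submodule.smul_mem _ _ hx
  -- The remainder t lies in the q-eigenspace as well as in the sum of the others, so it is zero by
  -- independence of eigenspaces.
  obtain ⟨s, hs, t, ht, hst⟩ := Submodule.mem_sup.1 (hall a)
  have h1 : t ∈ φ.eigenspace q := by
    have : t = QGrassLoc.of q h a - s := by rw [← hst, add_sub_cancel_left]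
    rw [this]
    exact Submodule.sub_mem _ (hφ a q ha) (hN hs)
  have h2 : t = 0 := by
    have := (Module.End.eigenspaces_iSupIndep φ q).le_bot ⟨h1, ht⟩
    simpa using this
  rw [← hst, h2, add_zero]
  exact hs

/-- Since 2k ≤ n, the columns up to the k-th lie outside those of [w]; only the single column beyond
them may be shared. -/
theorem card_filter_xSet_lt (i : Fin k) (j : Fin (n - k)) (h2 : 2 * k ≤ n) :
    ((xSet i j).filter fun c => c.val + k < n).card = k ∨
      ((xSet i j).filter fun c => c.val + k < n).card + 1 = k := by
  have hj := j.isLt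
  have hi := i.isLt
  by_cases hjn : j.val + k + k < n
  · left
    rw [Finset.filter_true_of_mem, card_xSet]
    intro c hc
    rw [mem_xSet] at hc
    omega
  · right
    have hb : (⟨j.val + k, by omega⟩ : Fin n) ∈ xSet i j := by simp [mem_xSet]
    have : (xSet i j).filter (fun c => c.val + k < n)
        = (xSet i j).erase ⟨j.val + k, by omega⟩ := by
      ext c
      simp only [Finset.mem_filter, Finset.mem_erase, mem_xSet, ne_eq, Fin.ext_iff]
      omega
    rw [this, Finset.card_erase_add_one hb, card_xSet]

theorem u_mul_w (hq : q ≠ 0) (h : k ≤ n) (h2 : 2 * k ≤ n) :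
    QGrass.u q h * QGrass.w q h = q ^ k • (QGrass.w q h * QGrass.u q h) := by
  have h1 := plucker_mul_w hq h (uSet k n) (card_uSet h)
  rwa [Finset.filter_true_of_mem, card_uSet h] at h1
  intro c hc
  simp only [uSet, Finset.mem_filter, Finset.mem_univ, true_and] at hc
  omega

theorem pluckerMulPow_mul_w (hq : q ≠ 0) (h : k ≤ n) (h2 : 2 * k ≤ n)
    (p : (Fin k × Fin (n - k)) × ℕ) :
    pluckerMulPow q h p * QGrass.w q h
      = q ^ (((xSet p.1.1 p.1.2).filter fun c => c.val + k < n).card + k * p.2)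
        • (QGrass.w q h * pluckerMulPow q h p) := by
  have hpow : ∀ d : ℕ, QGrass.u q h ^ d * QGrass.w q h
      = q ^ (k * d) • (QGrass.w q h * QGrass.u q h ^ d) := by
    intro d
    induction d with
    | zero => simp
    | succ d ih =>
      rw [pow_succ, mul_assoc, u_mul_w hq h h2, mul_smul_comm, ← mul_assoc, ih, smul_mul_assoc,
        smul_smul, ← pow_add, mul_assoc]
      congr 2
      ring
  rw [pluckerMulPow, mul_assoc, hpow, mul_smul_comm, ← mul_assoc, plucker_mul_w hq h,
    smul_mul_assoc, smul_smul, pow_add, mul_comm (q ^ (k * p.2)), mul_assoc]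

/-- The elements of the quantum grassmannian that have the commutation relations of the numerator
of a generator of `R` with both `[u]` and `[w]`. -/
theorem of_mem_span_plucker (hq0 : q ≠ 0) (hq : ∀ m : ℕ, 0 < m → q ^ m ≠ 1) (hk : 2 ≤ k)
    (h : k ≤ n) (h2 : 2 * k ≤ n) (a : QGrass q k n) (e : ℕ) (he : e ≤ k)
    (hu : QGrass.u q h * a = q • (a * QGrass.u q h))
    (hw : a * QGrass.w q h = q ^ e • (QGrass.w q h * a)) :
    QGrassLoc.of q h a
      ∈ Submodule.span K (Set.range fun p : Fin k × Fin (n - k) =>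
        QGrassLoc.of q h (plucker q (xSet p.1 p.2) (card_xSet p.1 p.2))) := by
  obtain ⟨c, hc⟩ := Finsupp.mem_span_range_iff_exists_finsupp.1
    (of_mem_span_of_qcommute hq0 hq h a hu)
  have h1 : ∑ p ∈ c.support, (c p * (q ^ (((xSet p.1.1 p.1.2).filter fun c => c.val + k < n).card
      + k * p.2) - q ^ e)) • QGrassLoc.of q h (QGrass.w q h * pluckerMulPow q h p) = 0 := by
    have h3 := congrArg (QGrassLoc.of q h) hw
    rw [map_mul, map_smul, map_mul, ← hc, Finsupp.sum, Finset.sum_mul, Finset.mul_sum,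
      Finset.smul_sum, ← sub_eq_zero, ← Finset.sum_sub_distrib] at h3
    rw [← h3]
    refine Finset.sum_congr rfl fun p _ => ?_
    rw [smul_mul_assoc, ← map_mul, pluckerMulPow_mul_w hq0 h h2, map_smul, mul_smul_comm, ← map_mul,
      smul_smul, smul_smul, ← sub_smul]
    congr 1
    ring
  -- Each term with nonzero coefficient must have the same commutation exponent with [w] as the
  -- given element.
  have h3 := linearIndependent_iff'.1 (linearIndependent_w_mul hq0 h) _ _ h1
  rw [← hc]
  refine Submodule.sum_mem _ fun p hp => Submodule.smul_mem _ _ (Submodule.subset_span ⟨p.1, ?_⟩)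
  have h4 : p.2 = 0 := by
    by_contra hd
    have h5 := (mul_eq_zero.1 (h3 p hp)).resolve_left (Finsupp.mem_support_iff.1 hp)
    have h6 := pow_injective_of_not_root hq0 hq (sub_eq_zero.1 h5)
    have h7 : k ≤ k * p.2 := Nat.le_mul_of_pos_right k (Nat.pos_of_ne_zero hd)
    -- With a positive power of [u] the exponent is at least (k-1) + k, which exceeds k ≥ e because
    -- k ≥ 2.
    rcases card_filter_xSet_lt p.1.1 p.1.2 h2 with h8 | h8 <;> omega
  simp [pluckerMulPow, h4]

end Decomposition

/-! ### The derivation on the generators of the quantum matrix subalgebra -/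

section Derivation

variable {K : Type u} [Field K] {q : K} {k n : ℕ}

theorem QGrassLoc.IsExtension.uInv_eq_zero {h : k ≤ n} {D : QGrass q k n →ₗ[K] QGrass q k n}
    (hu : D (QGrass.u q h) = 0) {D' : QGrassLoc q h →ₗ[K] QGrassLoc q h}
    (hD' : QGrassLoc.IsExtension q h D D') : D' (QGrassLoc.uInv q h) = 0 := by
  have h1 := hD'.1 (QGrassLoc.of q h (QGrass.u q h)) (QGrassLoc.uInv q h)
  rw [InvertAt.of_mul_inv, hD'.1.map_one, hD'.2, hu, map_zero, zero_mul, zero_add] at h1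
  have h2 := congrArg (QGrassLoc.uInv q h * ·) h1
  simp only [mul_zero, ← mul_assoc, InvertAt.inv_mul_of, one_mul] at h2
  exact h2.symm

/-- D commutes with multiplication by its constants [u] and [w], so D g inherits the relations of g;
hence D(g[u]⁻¹) = D(g)[u]⁻¹ is even a linear combination of the generators of `R`. -/
theorem QGrassLoc.IsExtension.x_mem (hq0 : q ≠ 0) (hq : ∀ m : ℕ, 0 < m → q ^ m ≠ 1) (hk : 2 ≤ k)
    {h : k ≤ n} (h2 : 2 * k ≤ n) {D : QGrass q k n →ₗ[K] QGrass q k n} (hD : IsDeriv D)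
    (hu : D (QGrass.u q h) = 0) (hw : D (QGrass.w q h) = 0)
    {D' : QGrassLoc q h →ₗ[K] QGrassLoc q h} (hD' : QGrassLoc.IsExtension q h D D')
    (i : Fin k) (j : Fin (n - k)) : D' (QGrassLoc.x q h i j) ∈ QGrassLoc.R q h := by
  let g := plucker q (xSet i j) (card_xSet i j)
  have hgu : QGrass.u q h * D g = q • (D g * QGrass.u q h) := by
    have h1 : ((xSet i j).filter fun c => k ≤ c.val).card = 1 := by
      rw [Finset.card_eq_one]
      refine ⟨⟨j.val + k, by have := j.isLt; omega⟩, ?_⟩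
      ext c
      simp only [Finset.mem_filter, mem_xSet, Finset.mem_singleton, Fin.ext_iff]
      omega
    have h3 := congrArg D (u_mul_plucker hq0 h (xSet i j) (card_xSet i j))
    rwa [h1, pow_one, map_smul, hD, hD, hu, zero_mul, zero_add, mul_zero, add_zero] at h3
  have hgw : D g * QGrass.w q h
      = q ^ ((xSet i j).filter fun c => c.val + k < n).card • (QGrass.w q h * D g) := by
    have h3 := congrArg D (plucker_mul_w hq0 h (xSet i j) (card_xSet i j))
    rwa [map_smul, hD, hD, hw, zero_mul, zero_add, mul_zero, add_zero] at h3
  have he : ((xSet i j).filter fun c => c.val + k < n).card ≤ k := by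
    rcases card_filter_xSet_lt i j h2 with h | h <;> omega
  have hmem := of_mem_span_plucker hq0 hq hk h h2 (D g) _ he hgu hgw
  rw [QGrassLoc.x, hD'.1, QGrassLoc.IsExtension.uInv_eq_zero hu hD', mul_zero, add_zero, hD'.2]
  change QGrassLoc.of q h (D g) * _ ∈ _
  generalize QGrassLoc.of q h (D g) = z at hmem ⊢
  induction hmem using Submodule.span_induction with
  | mem y hy =>
    obtain ⟨p, rfl⟩ := hy
    exact Algebra.subset_adjoin ⟨p.1, p.2, rfl⟩
  | zero => rw [zero_mul]; exact Subalgebra.zero_mem _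
  | add y z _ _ hy hz => rw [add_mul]; exact Subalgebra.add_mem _ hy hz
  | smul r y _ hy => rw [smul_mul_assoc]; exact Subalgebra.smul_mem _ hy r

end Derivation

theorem mainTheorem4 {K : Type*} [Field K] [CharZero K] (q : K) (hq0 : q ≠ 0)
    (hq : ∀ m : ℕ, 0 < m → q ^ m ≠ 1) (k n : ℕ) (hk : 2 ≤ k) (hkn : k ≤ n) (h2k : 2 * k ≤ n)
    (D : QGrass q k n →ₗ[K] QGrass q k n) (hD : IsDeriv D)
    (hu : D (QGrass.u q hkn) = 0) (hw : D (QGrass.w q hkn) = 0) :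
    (∃! D' : QGrassLoc q hkn →ₗ[K] QGrassLoc q hkn, QGrassLoc.IsExtension q hkn D D') ∧
    ∀ D' : QGrassLoc q hkn →ₗ[K] QGrassLoc q hkn, QGrassLoc.IsExtension q hkn D D' →
      D' (QGrassLoc.uInv q hkn) = 0 ∧
      ∀ r ∈ QGrassLoc.R q hkn, D' r ∈ QGrassLoc.R q hkn := by
  refine ⟨?_, fun D' hD' => ⟨QGrassLoc.IsExtension.uInv_eq_zero hu hD', fun r hr => ?_⟩⟩
  · obtain ⟨D', h1, h2⟩ := InvertAt.exists_derivation (QGrass.u q hkn) D hD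
    refine ⟨D', ⟨h1, h2⟩, fun D'' h3 => ?_⟩
    exact InvertAt.derivation_ext h3.1 h1 fun a => (h3.2 a).trans (h2 a).symm
  -- By the Leibniz rule it suffices to treat the generators of `R`.
  · induction hr using Algebra.adjoin_induction with
    | mem y hy =>
      obtain ⟨i, j, rfl⟩ := hy
      exact QGrassLoc.IsExtension.x_mem hq0 hq hk h2k hD hu hw hD' i j
    | algebraMap r => rw [hD'.1.map_algebraMap]; exact Subalgebra.zero_mem _
    | add y z _ _ hy hz => rw [map_add]; exact Subalgebra.add_mem _ hy hz
    | mul y z hy' hz' hy hz =>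
      rw [hD'.1]
      exact Subalgebra.add_mem _ (Subalgebra.mul_mem _ hy hz') (Subalgebra.mul_mem _ hy' hz)
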